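/- Let $0<\eta<1$, $S=\mathrm{diag}(1+\eta,1-\eta)$, and let $m_1,\dots,m_4>0$. A collision-free planar configuration $q=(q_1,\dots,q_4)$, $q_j=(x_j,y_j)\in\mathbb R^2$, is called $S$-balanced if $\lambda S q_j=\sum_{k\ne j} m_k (q_k-q_j)/\|q_k-q_j\|^3$ for all $j$ and some $\lambda\in\mathbb R$; then $\lambda<0$, and up to dilation we normalize $\lambda=-1$. Complexification. Let $\mathcal A$ be the set of all $(\mathcal Z,\mathcal W)$, $\mathcal Z=(z_j,Z_{ij})$, $\mathcal W=(w_j,W_{ij})$ with complex entries, for which there are $r_{ij}=r_{ji}\in\mathbb C$, nonzero for $i\neq j$, such that, with $z_{ij}=z_j-z_i$ and $w_{ij}=w_j-w_i$, one has $r_{ij}^2=z_{ij}w_{ij}$, $Z_{ij}=r_{ij}^{-3}z_{ij}$, $W_{ij}=r_{ij}^{-3}w_{ij}$, and $$z_j=\tfrac{1}{1-\eta^2}\sum_{k\ne j}m_kZ_{kj}-\tfrac{\eta}{1-\eta^2}\sum_{k\ne j}m_kW_{kj},\qquad w_j=\tfrac{1}{1-\eta^2}\sum_{k\ne j}m_kW_{kj}-\tfrac{\eta}{1-\eta^2}\sum_{k\ne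 j}m_kZ_{kj}.$$ A normalized $S$-balanced configuration is regarded as a point of $\mathcal A$ by $z_j=x_j+iy_j$, $w_j=x_j-iy_j$, $r_{ij}=\|q_i-q_j\|$. Let $\mathcal A_{\mathbb R}\subset\mathcal A$ be the set of points of $\mathcal A$ in the Zariski closure of the set of normalized $S$-balanced configurations. Write $I_S=\sum_j m_j\big((1+\eta)x_j^2+(1-\eta)y_j^2\big)$ with $x_j=\frac{z_j+w_j}{2}$, $y_j=\frac{z_j-w_j}{2i}$ for the $S$-moment of inertia on $\mathcal A$ (it is positive at real configurations). Let $\|\mathcal Z\|$, $\|\mathcal W\|$ be the maxima of the absolute values of the entries. A singular sequence in $X\subset\mathcal A$ is a sequence in $X$ with $\max(\|\mathcal Z\|,\|\mathcal W\|)\to\infty$; it is of equal order if, for some constants $c,C>0$, $c\|\mathcal W\|\le\|\mathcal Z\|\le C\|\mathcal W\|$ for all large $n$. Exceptional masses. Let $\mathcal M_\eta$ be the set of masses such that, for some relabelling of the four bodies, at least one of the following holds: - (II) $(m_1m_4-m_2m_3)^2=\eta^2(m_1+m_2)(m_3+m_4)(m_1+m_3)(m_2+m_4)$; - (III) $\eta^2(m_1+m_2)(m_2+m_3)=m_1m_3$;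 - (IV) $m_2m_4=m_3m_1$ and $m_1m_4^2+m_4m_1^2=\eta^2\big((m_1+m_2)m_4^2+(m_3+m_4)m_1^2\big)$; - (V-2) $m_1(m_3+m_4)^2+m_4(m_1+m_2)^2+\frac{(m_1m_3-m_2m_4)^2}{m_2+m_3}=\eta^2\big((m_1+m_2)(m_3+m_4)^2+(m_3+m_4)(m_1+m_2)^2\big)$; - (VI) $m_1(m_2+m_4)=\eta^2(m_1+m_3)(m_2+m_3+m_4)$; - (VIII) $\frac1{\sqrt{m_1}}=\frac1{\sqrt{m_2}}+\frac1{\sqrt{m_3}}$. Proposition. Suppose that $(m_1,m_2,m_3,m_4)\notin\mathcal M_\eta$. If there are infinitely many $S$-balanced configurations up to dilation, then singular sequences in $\mathcal A_{\mathbb R}$ exist; and no singular sequence in $\mathcal A_{\mathbb R}$ is of equal order. More generally, no singular sequence in $\mathcal A$ along which $I_S\neq0$ is of equal order. -/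

import Mathlib

open Filter Asymptotics

/-- A planar configuration `q` of four bodies of masses `m`, without collision, is `S`-balanced with
multiplier `lam` if `lam • S q_j = ∑_{k ≠ j} m_k (q_k - q_j) / ‖q_k - q_j‖ ^ 3` for every `j`. -/
def IsBalancedConfiguration (S : Matrix (Fin 2) (Fin 2) ℝ) (m : Fin 4 → ℝ) (lam : ℝ)
    (q : Fin 4 → EuclideanSpace ℝ (Fin 2)) : Prop :=
  (∀ j k, j ≠ k → q j ≠ q k) ∧
    ∀ j, lam • Matrix.toEuclideanLin S (q j) =
      ∑ k ∈ Finset.univ.erase j, (m k / ‖q k - q j‖ ^ 3) • (q k - q j)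

/-- The normalized matrix `S` (trace `2`, eigenvalues `1 + η` and `1 - η`), written in an orthonormal
basis of eigenvectors. -/
def balancedMatrix (η : ℝ) : Matrix (Fin 2) (Fin 2) ℝ :=
  Matrix.diagonal ![1 + η, 1 - η]

/-- One representative for each dilation class of `S`-balanced configurations: for positive masses
the multiplier is always negative, and the unique positive dilation that makes it `-1` is applied. -/
def normalizedBalancedConfigurations (η : ℝ) (m : Fin 4 → ℝ) :
    Set (Fin 4 → EuclideanSpace ℝ (Fin 2)) :=
  {q | IsBalancedConfiguration (balancedMatrix η) m (-1) q}

/-- A point `(𝒵, 𝒲)` of the complex space in which balanced configurations are embedded, with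
`𝒵 = (z_j, Z_ij)` and `𝒲 = (w_j, W_ij)`. -/
structure ComplexPoint where
  z : Fin 4 → ℂ
  Z : Fin 4 → Fin 4 → ℂ
  w : Fin 4 → ℂ
  W : Fin 4 → Fin 4 → ℂ

namespace ComplexPoint

/-- `‖𝒵‖`: the maximum of the absolute values of the `z_j` and the `Z_ij`. -/
noncomputable def normZ (Q : ComplexPoint) : ℝ := ‖(Q.z, Q.Z)‖

/-- `‖𝒲‖`: the maximum of the absolute values of the `w_j` and the `W_ij`. -/
noncomputable def normW (Q : ComplexPoint) : ℝ := ‖(Q.w, Q.W)‖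

/-- All coordinates of a point. -/
def coord (Q : ComplexPoint) :
    (Fin 4 ⊕ (Fin 4 × Fin 4)) ⊕ (Fin 4 ⊕ (Fin 4 × Fin 4)) → ℂ :=
  Sum.elim (Sum.elim Q.z (fun p => Q.Z p.1 p.2)) (Sum.elim Q.w (fun p => Q.W p.1 p.2))

/-- The `S`-moment of inertia `∑ m_j ((1 + η) x_j ^ 2 + (1 - η) y_j ^ 2)`, in terms of
`z_j = x_j + i y_j` and `w_j = x_j - i y_j`. -/
noncomputable def momentOfInertia (η : ℝ) (m : Fin 4 → ℝ) (Q : ComplexPoint) : ℂ :=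
  ∑ j, (m j : ℂ) * ((1 + (η : ℂ)) * ((Q.z j + Q.w j) / 2) ^ 2 +
    (1 - (η : ℂ)) * ((Q.z j - Q.w j) / (2 * Complex.I)) ^ 2)

/-- The point that corresponds to a real configuration `q_j = (x_j, y_j)`: `z_j = x_j + i y_j`,
`w_j = x_j - i y_j`, `Z_ij = r_ij ^ (-3) z_ij` and `W_ij = r_ij ^ (-3) w_ij`, where
`r_ij = ‖q_i - q_j‖`, `z_ij = z_j - z_i` and `w_ij = w_j - w_i`. -/
noncomputable def ofReal (q : Fin 4 → EuclideanSpace ℝ (Fin 2)) : ComplexPoint where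
  z j := (q j 0 : ℂ) + Complex.I * (q j 1 : ℂ)
  Z i j := ((‖q i - q j‖ : ℂ) ^ 3)⁻¹ *
    (((q j 0 : ℂ) + Complex.I * (q j 1 : ℂ)) - ((q i 0 : ℂ) + Complex.I * (q i 1 : ℂ)))
  w j := (q j 0 : ℂ) - Complex.I * (q j 1 : ℂ)
  W i j := ((‖q i - q j‖ : ℂ) ^ 3)⁻¹ *
    (((q j 0 : ℂ) - Complex.I * (q j 1 : ℂ)) - ((q i 0 : ℂ) - Complex.I * (q i 1 : ℂ)))

end ComplexPoint

/-- The complex algebraic variety of `S`-balanced configurations: there are mutual distances `r_ij`,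
i.e. choices of the square roots of `z_ij w_ij`, with `Z_ij = r_ij ^ (-3) z_ij` and
`W_ij = r_ij ^ (-3) w_ij`, where `z_ij = z_j - z_i`, `w_ij = w_j - w_i`, and the equations of
balanced configurations hold. -/
def balancedVariety (η : ℝ) (m : Fin 4 → ℝ) : Set ComplexPoint :=
  {Q | (∃ r : Fin 4 → Fin 4 → ℂ,
      (∀ i j, r i j = r j i) ∧
      (∀ i j, i ≠ j → r i j ≠ 0) ∧
      (∀ i j, r i j ^ 2 = (Q.z j - Q.z i) * (Q.w j - Q.w i)) ∧
      (∀ i j, Q.Z i j = (r i j ^ 3)⁻¹ * (Q.z j - Q.z i)) ∧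
      (∀ i j, Q.W i j = (r i j ^ 3)⁻¹ * (Q.w j - Q.w i))) ∧
    (∀ j, Q.z j =
      1 / (1 - (η : ℂ) ^ 2) * ∑ k ∈ Finset.univ.erase j, (m k : ℂ) * Q.Z k j -
        (η : ℂ) / (1 - (η : ℂ) ^ 2) * ∑ k ∈ Finset.univ.erase j, (m k : ℂ) * Q.W k j) ∧
    (∀ j, Q.w j =
      1 / (1 - (η : ℂ) ^ 2) * ∑ k ∈ Finset.univ.erase j, (m k : ℂ) * Q.W k j -
        (η : ℂ) / (1 - (η : ℂ) ^ 2) * ∑ k ∈ Finset.univ.erase j, (m k : ℂ) * Q.Z k j)}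

/-- The part of the variety that is spanned by the actual (real) balanced configurations: the points
of the variety in the Zariski closure of the set of normalized balanced configurations. -/
def realBalancedVariety (η : ℝ) (m : Fin 4 → ℝ) : Set ComplexPoint :=
  {Q | Q ∈ balancedVariety η m ∧
    ∀ P : MvPolynomial ((Fin 4 ⊕ (Fin 4 × Fin 4)) ⊕ (Fin 4 ⊕ (Fin 4 × Fin 4))) ℂ,
      (∀ q ∈ normalizedBalancedConfigurations η m,
        MvPolynomial.eval (ComplexPoint.ofReal q).coord P = 0) →
      MvPolynomial.eval Q.coord P = 0}

/-- A singular sequence in `X`: a sequence of points of `X` with `max (‖𝒵‖, ‖𝒲‖) → ∞`. -/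
def IsSingularSequence (X : Set ComplexPoint) (Q : ℕ → ComplexPoint) : Prop :=
  (∀ n, Q n ∈ X) ∧ Tendsto (fun n => max (Q n).normZ (Q n).normW) atTop atTop

/-- `𝒵` and `𝒲` are of equal order along the sequence: each of `‖𝒵‖`, `‖𝒲‖` is bounded by a
constant multiple of the other one. -/
def IsOfEqualOrder (Q : ℕ → ComplexPoint) : Prop :=
  (fun n => (Q n).normZ) =Θ[atTop] (fun n => (Q n).normW)

/-- Mass condition of the quadrilateral diagram II. -/
def MassConditionII (η m₁ m₂ m₃ m₄ : ℝ) : Prop :=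
  (m₁ * m₄ - m₂ * m₃) ^ 2 = η ^ 2 * (m₁ + m₂) * (m₃ + m₄) * (m₁ + m₃) * (m₂ + m₄)

/-- Mass condition of diagram III. -/
def MassConditionIII (η m₁ m₂ m₃ : ℝ) : Prop :=
  η ^ 2 * (m₁ + m₂) * (m₂ + m₃) = m₁ * m₃

/-- Mass condition of diagram IV. -/
def MassConditionIV (η m₁ m₂ m₃ m₄ : ℝ) : Prop :=
  m₂ * m₄ = m₃ * m₁ ∧
    m₁ * m₄ ^ 2 + m₄ * m₁ ^ 2 = η ^ 2 * ((m₁ + m₂) * m₄ ^ 2 + (m₃ + m₄) * m₁ ^ 2)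

/-- Mass condition of diagram V-2. -/
def MassConditionV2 (η m₁ m₂ m₃ m₄ : ℝ) : Prop :=
  m₁ * (m₃ + m₄) ^ 2 + m₄ * (m₁ + m₂) ^ 2 + (m₁ * m₃ - m₂ * m₄) ^ 2 / (m₂ + m₃) =
    η ^ 2 * ((m₁ + m₂) * (m₃ + m₄) ^ 2 + (m₃ + m₄) * (m₁ + m₂) ^ 2)

/-- Mass condition of diagram VI. -/
def MassConditionVI (η m₁ m₂ m₃ m₄ : ℝ) : Prop :=
  m₁ * (m₂ + m₄) = η ^ 2 * (m₁ + m₃) * (m₂ + m₃ + m₄)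

/-- Mass condition of diagram VIII. -/
def MassConditionVIII (m₁ m₂ m₃ : ℝ) : Prop :=
  1 / Real.sqrt m₁ = 1 / Real.sqrt m₂ + 1 / Real.sqrt m₃

/-- The exceptional set of masses: one of the mass conditions II, III, IV, V-2, VI, VIII holds for
some labelling of the four bodies. -/
def exceptionalMasses (η : ℝ) : Set (Fin 4 → ℝ) :=
  {m | ∃ σ : Equiv.Perm (Fin 4),
    MassConditionII η (m (σ 0)) (m (σ 1)) (m (σ 2)) (m (σ 3)) ∨
    MassConditionIII η (m (σ 0)) (m (σ 1)) (m (σ 2)) ∨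
    MassConditionIV η (m (σ 0)) (m (σ 1)) (m (σ 2)) (m (σ 3)) ∨
    MassConditionV2 η (m (σ 0)) (m (σ 1)) (m (σ 2)) (m (σ 3)) ∨
    MassConditionVI η (m (σ 0)) (m (σ 1)) (m (σ 2)) (m (σ 3)) ∨
    MassConditionVIII (m (σ 0)) (m (σ 1)) (m (σ 2))}

/-!
The equations of `balancedVariety` become polynomial once `1 / r_ij` is written `Z_ij w_ij`
(`SatisfiesBalancedEquations`), so they hold on Zariski closures and in function fields.

*Existence.* The Zariski closure of the normalized configurations is an algebraic subset of affine
space, and a bounded algebraic set is finite (`MvPolynomial.finite_zeroLocus_of_isBounded`).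

*The moment of inertia.* The equations say that `I_S / 2 + U` is critical, where `U` is the potential,
and by homogeneity `I_S = U`. Hence `dI_S = -2 dU = -2 dI_S`, and `I_S` is constant on each irreducible
component: it has finitely many values on the variety (`finite_momentOfInertia_image`). These values
are positive at real configurations, so `I_S` has no zero on their Zariski closure, and the second
assertion is a case of the third one. Moreover `I_S = U` stays bounded, and bounded away from zero,
where it does not vanish.

*Equal order.* Let `s ^ (-2)` be the order of the sequence. After rescaling by `s ^ 2` all coordinates
have limits along an ultrafilter (`SingularLimit`): `ζ`, `ω` for the positions, `α`, `β` for the `Z_ij`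
and `W_ij`. Pairs with `α ≠ 0` or `β ≠ 0` are the strokes of two colours. A stroke of one colour
forces equal limit positions in the other coordinates, and the forces inside a class of bodies joined
by strokes cancel. So `ω` is constant on the classes of the first colour, `ζ` on those of the second,
and each is, up to the factor `-η`, the class average of the other one (`ClassRelations`).

If `ζ` and `ω` are not both zero, there are bodies `i`, `j`, `k` such that `i`, `j` are in one class
of the first colour and `j`, `k` in one class of the second, but `ζ_i ≠ ζ_j` and `ω_j ≠ ω_k`. The
fourth body leaves nine cases. In eight of them elimination gives one of the mass conditions II, III,
V-2, VI; condition IV is a special case of V-2 and is not needed. In the ninth one all distances but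
one are bounded below, hence by the potential all of them are, although the strokes force two bodies
to collide (`SingularLimit.not_overlapping_triples`).

If `ζ = ω = 0`, no body has exactly one stroke of a colour. Comparing the orders of the `z_ij` and
`w_ij` in triangles shows that either all pairs carry both colours or exactly one triangle does
(`SingularLimit.full_or_triangle`). In the first case all bodies tend to the centre of mass and `I_S`
tends to zero, which is excluded; in the second case the sides of the triangle close up only under
condition VIII (`SingularLimit.massConditionVIII_of_triangle`).
-/

/-! ### Algebraic sets over the complex numbers -/

/-- A bounded algebraic subset of affine space over `ℂ` is finite: by Noether normalization a
positive-dimensional one maps onto an affine line by a polynomial. -/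
theorem MvPolynomial.finite_zeroLocus_of_isBounded {σ : Type} [Fintype σ]
    (I : Ideal (MvPolynomial σ ℂ)) (hV : Bornology.IsBounded (zeroLocus ℂ I)) :
    (zeroLocus ℂ I).Finite := by
  classical
  rcases eq_or_ne I ⊤ with rfl | hI
  · simp
  have : Nontrivial (MvPolynomial σ ℂ ⧸ I) := Ideal.Quotient.nontrivial_iff.mpr hI
  obtain ⟨s, g, hg, hfin⟩ := exists_finite_inj_algHom_of_fg ℂ (MvPolynomial σ ℂ ⧸ I)
  have hint : g.toRingHom.IsIntegral := RingHom.IsIntegral.of_finite hfin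
  rcases s.eq_zero_or_pos with rfl | hs
  · have hfd : FiniteDimensional ℂ (MvPolynomial σ ℂ ⧸ I) := by
      have h1 : ((algebraMap ℂ (MvPolynomial (Fin 0) ℂ))).Finite :=
        RingHom.Finite.of_surjective _ (MvPolynomial.C_surjective (Fin 0))
      have h2 := RingHom.Finite.comp (g := g.toRingHom) hfin h1
      have h3 : g.toRingHom.comp (algebraMap ℂ (MvPolynomial (Fin 0) ℂ)) =
          algebraMap ℂ (MvPolynomial σ ℂ ⧸ I) := g.comp_algebraMap
      rw [h3] at h2
      exact RingHom.finite_algebraMap.mp h2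
    let F : zeroLocus ℂ I → ((MvPolynomial σ ℂ ⧸ I) →ₐ[ℂ] ℂ) := fun x =>
      Ideal.Quotient.liftₐ I (aeval x.1) (fun p hp => x.2 p hp)
    have hF : Function.Injective F := by
      intro x y hxy
      ext i
      have := congrArg (fun φ => φ (Ideal.Quotient.mk I (X i))) hxy
      simpa [F] using this
    exact Set.finite_coe_iff.mp (Finite.of_injective F hF)
  · obtain ⟨P, hP⟩ := Ideal.Quotient.mk_surjective (g (X ⟨0, hs⟩))
    obtain ⟨B, hB⟩ : ∃ B : ℝ, ∀ x ∈ zeroLocus ℂ I, ‖aeval x P‖ ≤ B := by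
      have hc : IsCompact (closure (zeroLocus ℂ I)) := hV.isCompact_closure
      have hcont : Continuous fun x : σ → ℂ => aeval x P := by
        simpa [MvPolynomial.aeval_eq_eval] using MvPolynomial.continuous_eval P
      obtain ⟨B, hB⟩ := hc.exists_bound_of_continuousOn hcont.continuousOn
      exact ⟨B, fun x hx => hB x (subset_closure hx)⟩
    exfalso
    let c : Fin s → ℂ := fun _ => ((|B| + 1 : ℝ) : ℂ)
    have hmax : (vanishingIdeal ℂ {c} : Ideal (MvPolynomial (Fin s) ℂ)).IsMaximal := inferInstance
    algebraize [g.toRingHom]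
    have : Algebra.IsIntegral (MvPolynomial (Fin s) ℂ) (MvPolynomial σ ℂ ⧸ I) := ⟨hint⟩
    have : FaithfulSMul (MvPolynomial (Fin s) ℂ) (MvPolynomial σ ℂ ⧸ I) :=
      (faithfulSMul_iff_algebraMap_injective _ _).mpr hg
    obtain ⟨Q, hQ, hQc⟩ := Ideal.exists_ideal_over_maximal_of_isIntegral
      (S := MvPolynomial σ ℂ ⧸ I) (vanishingIdeal ℂ {c}) (by
        rw [(RingHom.injective_iff_ker_eq_bot (algebraMap (MvPolynomial (Fin s) ℂ)
          (MvPolynomial σ ℂ ⧸ I))).mp (FaithfulSMul.algebraMap_injective _ _)]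
        exact bot_le)
    have hQ' : (Q.comap (Ideal.Quotient.mk I)).IsMaximal :=
      Ideal.comap_isMaximal_of_surjective _ Ideal.Quotient.mk_surjective
    obtain ⟨x, hx⟩ := (isMaximal_iff_eq_vanishingIdeal_singleton).mp hQ'
    have hxV : x ∈ zeroLocus ℂ I := by
      intro p hp
      have : p ∈ Q.comap (Ideal.Quotient.mk I) := by
        rw [Ideal.mem_comap, Ideal.Quotient.eq_zero_iff_mem.mpr hp]; exact zero_mem _
      rw [hx] at this
      exact this x rfl
    have hval : aeval x P = ((|B| + 1 : ℝ) : ℂ) := by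
      have h1 : (X ⟨0, hs⟩ - C ((|B| + 1 : ℝ) : ℂ) : MvPolynomial (Fin s) ℂ) ∈
          (vanishingIdeal ℂ {c} : Ideal (MvPolynomial (Fin s) ℂ)) := by
        rw [mem_vanishingIdeal_singleton_iff]; simp [c]
      rw [← hQc, Ideal.mem_comap] at h1
      have h2 : (P - C ((|B| + 1 : ℝ) : ℂ)) ∈ Q.comap (Ideal.Quotient.mk I) := by
        rw [Ideal.mem_comap]
        convert h1 using 1
        rw [map_sub, map_sub, hP]
        congr 1
        exact (g.commutes _).symm
      rw [hx, mem_vanishingIdeal_singleton_iff] at h2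
      rw [map_sub, sub_eq_zero] at h2
      simpa using h2
    have := hB x hxV
    rw [hval, Complex.norm_real, Real.norm_eq_abs] at this
    linarith [le_abs_self B, le_abs_self (|B| + 1)]

open Polynomial in
/-- In characteristic zero, an element with vanishing differential is algebraic. -/
theorem isAlgebraic_of_kaehlerDifferential_D_eq_zero {k K : Type} [Field k] [CharZero k] [Field K]
    [Algebra k K] [Algebra.EssFiniteType k K] (f : K)
    (hf : KaehlerDifferential.D k K f = 0) : IsAlgebraic k f := by
  by_contra hT
  have hinj : Function.Injective (aeval (R := k) f) := transcendental_iff_injective.mp hT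
  let A : Algebra k[X] K := (aeval (R := k) f).toAlgebra
  have hst : IsScalarTower k k[X] K := IsScalarTower.of_algebraMap_eq' (aeval f).comp_algebraMap.symm
  have hfs : FaithfulSMul k[X] K := (faithfulSMul_iff_algebraMap_injective _ _).mpr hinj
  let A' : Algebra (FractionRing k[X]) K := FractionRing.liftAlgebra k[X] K
  have hst' : IsScalarTower k[X] (FractionRing k[X]) K := FractionRing.isScalarTower_liftAlgebra _ _
  have hst'' : IsScalarTower k (FractionRing k[X]) K := by
    refine IsScalarTower.of_algebraMap_eq fun x => ?_
    rw [IsScalarTower.algebraMap_apply k k[X] K, IsScalarTower.algebraMap_apply k[X] (FractionRing k[X]) K,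
      IsScalarTower.algebraMap_apply k k[X] (FractionRing k[X])]
  have : CharZero (FractionRing k[X]) := charZero_of_injective_algebraMap (algebraMap k _).injective
  have : Algebra.EssFiniteType (FractionRing k[X]) K := Algebra.EssFiniteType.of_comp k _ _
  have h1 : Algebra.FormallySmooth k[X] (FractionRing k[X]) :=
    .of_isLocalization (nonZeroDivisors k[X])
  have h2 : Algebra.FormallySmooth k[X] K := .comp k[X] (FractionRing k[X]) K
  have hbc : Function.Injective (KaehlerDifferential.mapBaseChange k k[X] K) := by
    rw [injective_iff_map_eq_zero]
    intro x hx
    obtain ⟨y, rfl⟩ := (Algebra.H1Cotangent.exact_δ_mapBaseChange k k[X] K x).mp hx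
    rw [Subsingleton.elim y 0, map_zero]
  have h3 : (1 : K) ⊗ₜ[k[X]] (KaehlerDifferential.D k k[X] X) = 0 := by
    apply hbc
    rw [KaehlerDifferential.mapBaseChange_tmul, KaehlerDifferential.map_D, map_zero, one_smul]
    have : algebraMap k[X] K X = f := aeval_X f
    rw [this, hf]
  have h4 : TensorProduct.rid k[X] K (LinearMap.lTensor K
      (KaehlerDifferential.polynomialEquiv k).toLinearMap
      ((1 : K) ⊗ₜ[k[X]] (KaehlerDifferential.D k k[X] X))) = 0 := by
    rw [h3, map_zero, map_zero]
  simp at h4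

/-- A polynomial function whose differential vanishes on an algebraic set (read in every field
generated by a point of its closure) takes finitely many values there: it is constant on each
irreducible component. -/
theorem MvPolynomial.finite_values_of_kaehlerDifferential_eq_zero {σ : Type} [Fintype σ]
    (V : Set (σ → ℂ)) (f : MvPolynomial σ ℂ)
    (h : ∀ (K : Type) [Field K] [Algebra ℂ K] (φ : MvPolynomial σ ℂ →ₐ[ℂ] K),
      (∀ p ∈ vanishingIdeal ℂ V, φ p = 0) → KaehlerDifferential.D ℂ K (φ f) = 0) :
    ((fun x => aeval x f) '' V).Finite := by
  have hfin := Ideal.finite_minimalPrimes_of_isNoetherianRing (MvPolynomial σ ℂ)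
    (vanishingIdeal ℂ V)
  have key : ∀ p : Ideal (MvPolynomial σ ℂ), p ∈ (vanishingIdeal ℂ V).minimalPrimes →
      ∃ c : ℂ, f - C c ∈ p := by
    intro p hp
    have hpp : p.IsPrime := hp.1.1
    let K := FractionRing (MvPolynomial σ ℂ ⧸ p)
    let φ : MvPolynomial σ ℂ →ₐ[ℂ] K :=
      (IsScalarTower.toAlgHom ℂ (MvPolynomial σ ℂ ⧸ p) K).comp (Ideal.Quotient.mkₐ ℂ p)
    have hφ : ∀ q, φ q = 0 ↔ q ∈ p := fun q => by
      rw [← Ideal.Quotient.eq_zero_iff_mem]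
      exact FaithfulSMul.algebraMap_eq_zero_iff (MvPolynomial σ ℂ ⧸ p) K
    have : Algebra.EssFiniteType ℂ K := Algebra.EssFiniteType.comp ℂ (MvPolynomial σ ℂ ⧸ p) K
    have halg : IsAlgebraic ℂ (φ f) := isAlgebraic_of_kaehlerDifferential_D_eq_zero _
      (h K φ fun q hq => (hφ q).mpr (hp.1.2 hq))
    obtain ⟨c, hc⟩ := minpoly.mem_range_of_degree_eq_one ℂ (φ f)
      (IsAlgClosed.degree_eq_one_of_irreducible ℂ (minpoly.irreducible halg.isIntegral))
    exact ⟨c, by rw [← hφ, map_sub, sub_eq_zero, ← hc]; exact (φ.commutes c).symm⟩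
  choose! c hc using key
  refine (hfin.image c).subset ?_
  rintro _ ⟨x, hx, rfl⟩
  have hle : vanishingIdeal ℂ V ≤ vanishingIdeal ℂ {x} :=
    vanishingIdeal_anti_mono (Set.singleton_subset_iff.mpr hx)
  obtain ⟨p, hp, hpx⟩ := Ideal.exists_minimalPrimes_le hle
  refine ⟨p, hp, ?_⟩
  have := (mem_vanishingIdeal_singleton_iff x _).mp (hpx (hc p hp))
  rw [map_sub, sub_eq_zero] at this
  simpa using this.symm

/-! ### The balanced equations over a commutative ring -/

/-- The equations of balanced configurations with the `r_ij` eliminated, over any `ℂ`-algebra. The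
last two say that `r_ij = 1 / (Z_ij w_ij) = 1 / (W_ij z_ij)` is a square root of `z_ij w_ij`; they
are polynomial, so they pass to Zariski closures and to function fields. -/
structure SatisfiesBalancedEquations {K : Type*} [CommRing K] [Algebra ℂ K] (η : ℝ)
    (m : Fin 4 → ℝ) (z w : Fin 4 → K) (Z W : Fin 4 → Fin 4 → K) : Prop where
  force_z : ∀ j, z j + algebraMap ℂ K η * w j = ∑ k, algebraMap ℂ K (m k) * Z k j
  force_w : ∀ j, w j + algebraMap ℂ K η * z j = ∑ k, algebraMap ℂ K (m k) * W k j
  diag_Z : ∀ j, Z j j = 0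
  diag_W : ∀ j, W j j = 0
  antisymm_Z : ∀ i j, Z i j = -Z j i
  antisymm_W : ∀ i j, W i j = -W j i
  cross : ∀ i j, Z i j * (w j - w i) = W i j * (z j - z i)
  normalized : ∀ i j, i ≠ j → (Z i j * (w j - w i)) ^ 2 * ((z j - z i) * (w j - w i)) = 1

theorem sum_erase_mul_of_diag_eq_zero (m : Fin 4 → ℝ) {A : Fin 4 → Fin 4 → ℂ}
    (hA : ∀ j, A j j = 0) (j : Fin 4) :
    ∑ k ∈ Finset.univ.erase j, (m k : ℂ) * A k j = ∑ k, (m k : ℂ) * A k j := by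
  rw [← Finset.add_sum_erase _ (fun k => (m k : ℂ) * A k j) (Finset.mem_univ j), hA, mul_zero,
    zero_add]

theorem one_sub_sq_ne_zero {η : ℝ} (hη₀ : 0 < η) (hη₁ : η < 1) : (1 - (η : ℂ) ^ 2) ≠ 0 := by
  have : (1 - η ^ 2 : ℝ) ≠ 0 := by nlinarith
  exact_mod_cast this

theorem satisfiesBalancedEquations_of_mem {η : ℝ} (hη₀ : 0 < η) (hη₁ : η < 1) {m : Fin 4 → ℝ}
    {Q : ComplexPoint} (hQ : Q ∈ balancedVariety η m) :
    SatisfiesBalancedEquations η m Q.z Q.w Q.Z Q.W := by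
  obtain ⟨⟨r, hsymm, hr, hr2, hZ, hW⟩, hz, hw⟩ := hQ
  have hη := one_sub_sq_ne_zero hη₀ hη₁
  have dZ : ∀ j, Q.Z j j = 0 := fun j => by simp [hZ]
  have dW : ∀ j, Q.W j j = 0 := fun j => by simp [hW]
  simp only [sum_erase_mul_of_diag_eq_zero m dZ, sum_erase_mul_of_diag_eq_zero m dW] at hz hw
  refine ⟨fun j => ?_, fun j => ?_, dZ, dW, fun i j => ?_, fun i j => ?_, fun i j => ?_,
    fun i j hij => ?_⟩
  · rw [hz j, hw j]; simp only [Algebra.algebraMap_self, RingHom.id_apply]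
    field_simp; ring
  · rw [hz j, hw j]; simp only [Algebra.algebraMap_self, RingHom.id_apply]
    field_simp; ring
  · rw [hZ, hZ, hsymm j i]; ring
  · rw [hW, hW, hsymm j i]; ring
  · rw [hZ, hW]; ring
  · rw [hZ]
    have h1 := hr i j hij
    have h2 := hr2 i j
    have : (r i j ^ 3)⁻¹ * (Q.z j - Q.z i) * (Q.w j - Q.w i) = (r i j)⁻¹ := by
      rw [mul_assoc, ← h2]; field_simp
    rw [this, ← h2]; field_simp

theorem mem_balancedVariety_of_satisfies {η : ℝ} (hη₀ : 0 < η) (hη₁ : η < 1) {m : Fin 4 → ℝ}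
    {Q : ComplexPoint} (h : SatisfiesBalancedEquations η m Q.z Q.w Q.Z Q.W) :
    Q ∈ balancedVariety η m := by
  have hη := one_sub_sq_ne_zero hη₀ hη₁
  refine ⟨⟨fun i j => if i = j then 0 else (Q.Z i j * (Q.w j - Q.w i))⁻¹, fun i j => ?_,
    fun i j hij => ?_, fun i j => ?_, fun i j => ?_, fun i j => ?_⟩, fun j => ?_, fun j => ?_⟩
  · simp only [eq_comm (a := j)]
    rw [h.antisymm_Z j i]; congr 2; ring
  · have := h.normalized i j hij
    simp only [hij, if_false]
    intro h0
    rw [inv_eq_zero] at h0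
    simp [h0] at this
  · by_cases hij : i = j
    · simp [hij]
    · have := h.normalized i j hij
      simp only [hij, if_false]
      have h0 : Q.Z i j * (Q.w j - Q.w i) ≠ 0 := fun h0 => by simp [h0] at this
      rw [inv_pow, inv_eq_iff_eq_inv, ← eq_inv_of_mul_eq_one_left this]
  · by_cases hij : i = j
    · simp [hij, h.diag_Z]
    · have := h.normalized i j hij
      simp only [hij, if_false]
      rw [inv_pow, inv_inv]
      linear_combination -Q.Z i j * this
  · by_cases hij : i = j
    · simp [hij, h.diag_W]
    · have := h.normalized i j hij
      simp only [hij, if_false]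
      rw [inv_pow, inv_inv]
      rw [h.cross i j] at this ⊢
      linear_combination -Q.W i j * this
  all_goals
    rw [sum_erase_mul_of_diag_eq_zero m h.diag_Z, sum_erase_mul_of_diag_eq_zero m h.diag_W]
    have h1 := h.force_z j
    have h2 := h.force_w j
    simp only [Algebra.algebraMap_self, RingHom.id_apply] at h1 h2
    rw [← h1, ← h2]
    field_simp
    ring

/-- Symmetrization of the sum over pairs of antisymmetric interactions. -/
theorem two_smul_sum_antisymm {K M : Type*} [CommRing K] [AddCommGroup M] [Module K M]
    (m : Fin 4 → K) (A : Fin 4 → Fin 4 → K) (hA : ∀ i j, A i j = -A j i) (v : Fin 4 → M) :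
    (2 : K) • ∑ j, ∑ k, (m j * m k * A k j) • v j =
      ∑ j, ∑ k, (m j * m k * A k j) • (v j - v k) := by
  simp only [smul_sub, Finset.sum_sub_distrib]
  rw [Finset.sum_comm (f := fun j k => (m j * m k * A k j) • v k), two_smul, sub_eq_add_neg]
  congr 1
  rw [← Finset.sum_neg_distrib]
  refine Finset.sum_congr rfl fun j _ => ?_
  rw [← Finset.sum_neg_distrib]
  refine Finset.sum_congr rfl fun k _ => ?_
  rw [hA j k, ← neg_smul]; congr 1; ring

namespace SatisfiesBalancedEquations

variable {K : Type*} [CommRing K] [Algebra ℂ K] {η : ℝ} {m : Fin 4 → ℝ} {z w : Fin 4 → K}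
  {Z W : Fin 4 → Fin 4 → K}

/-- The moment of inertia equals the potential: both sides are twice the usual quantity, with
`Z_kj w_kj = 1 / r_kj`. -/
theorem inertia_eq_potential (h : SatisfiesBalancedEquations η m z w Z W) :
    ∑ j, algebraMap ℂ K (m j) * (2 * z j * w j + algebraMap ℂ K η * (z j ^ 2 + w j ^ 2)) =
      ∑ j, ∑ k, algebraMap ℂ K (m j) * algebraMap ℂ K (m k) * (Z k j * (w j - w k)) := by
  have h2 : IsUnit (2 : K) := by
    have := (IsUnit.mk0 (2 : ℂ) two_ne_zero).map (algebraMap ℂ K)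
    rwa [map_ofNat] at this
  apply h2.mul_left_cancel
  have e1 := two_smul_sum_antisymm (fun j => algebraMap ℂ K (m j)) Z h.antisymm_Z w
  have e2 := two_smul_sum_antisymm (fun j => algebraMap ℂ K (m j)) W h.antisymm_W z
  simp only [smul_eq_mul] at e1 e2
  have e3 : ∑ j, algebraMap ℂ K (m j) *
      (2 * z j * w j + algebraMap ℂ K η * (z j ^ 2 + w j ^ 2)) =
      ∑ j, ∑ k, algebraMap ℂ K (m j) * algebraMap ℂ K (m k) * Z k j * w j +
      ∑ j, ∑ k, algebraMap ℂ K (m j) * algebraMap ℂ K (m k) * W k j * z j := by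
    rw [← Finset.sum_add_distrib]
    refine Finset.sum_congr rfl fun j _ => ?_
    have f1 : ∑ k, algebraMap ℂ K (m j) * algebraMap ℂ K (m k) * Z k j * w j =
        algebraMap ℂ K (m j) * w j * (z j + algebraMap ℂ K η * w j) := by
      rw [h.force_z, Finset.mul_sum]; exact Finset.sum_congr rfl fun k _ => by ring
    have f2 : ∑ k, algebraMap ℂ K (m j) * algebraMap ℂ K (m k) * W k j * z j =
        algebraMap ℂ K (m j) * z j * (w j + algebraMap ℂ K η * z j) := by
      rw [h.force_w, Finset.mul_sum]; exact Finset.sum_congr rfl fun k _ => by ring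
    rw [f1, f2]; ring
  rw [e3, mul_add, e1, e2, ← Finset.sum_add_distrib, Finset.mul_sum]
  refine Finset.sum_congr rfl fun j _ => ?_
  rw [← Finset.sum_add_distrib, Finset.mul_sum]
  refine Finset.sum_congr rfl fun k _ => ?_
  linear_combination (-algebraMap ℂ K (m j) * algebraMap ℂ K (m k)) * h.cross k j

/-- The relation `W dz + Z dw = -2 d(1 / r)`, from differentiating `r ^ (-2) z w = 1`. -/
theorem derivation_inv_distance {M : Type*} [AddCommGroup M] [Module K M] [Module ℂ M]
    (h : SatisfiesBalancedEquations η m z w Z W) (D : Derivation ℂ K M) (i j : Fin 4) :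
    W i j • D (z j - z i) + Z i j • D (w j - w i) = -((2 : K) • D (Z i j * (w j - w i))) := by
  by_cases hij : i = j
  · subst hij; simp
  have hn := h.normalized i j hij
  have hc := h.cross i j
  generalize Z i j = Z' at *
  generalize W i j = W' at *
  generalize w j - w i = w' at *
  generalize z j - z i = z' at *
  generalize hρ : Z' * w' = ρ at *
  have hD := congrArg (fun x => ρ • D x) hn
  simp only [Derivation.leibniz, Derivation.leibniz_pow, Derivation.map_one_eq_zero, smul_zero,
    smul_add, smul_smul] at hD
  have e1 : ρ * (ρ ^ 2 * z') = Z' := by linear_combination Z' * hn - ρ ^ 2 * z' * hρ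
  have e2 : ρ * (ρ ^ 2 * w') = W' := by linear_combination W' * hn + ρ ^ 2 * w' * hc
  rw [e1, e2] at hD
  have e3 : (ρ * (z' * w')) • (2 • ρ ^ (2 - 1) • D ρ) = (2 : K) • D ρ := by
    rw [← Nat.cast_smul_eq_nsmul K, smul_smul, smul_smul]
    congr 1
    push_cast; simp only [pow_one]; linear_combination 2 * hn
  rw [e3] at hD
  rw [eq_neg_iff_add_eq_zero, ← hD]; abel

/-- On a family of solutions the moment of inertia is stationary: its differential is `-2` times
that of the potential, to which it is equal. -/
theorem derivation_inertia_eq_zero {M : Type*} [AddCommGroup M] [Module K M] [Module ℂ M]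
    [IsScalarTower ℂ K M] (h : SatisfiesBalancedEquations η m z w Z W) (D : Derivation ℂ K M) :
    D (∑ j, algebraMap ℂ K (m j) *
      (2 * z j * w j + algebraMap ℂ K η * (z j ^ 2 + w j ^ 2))) = 0 := by
  have hc : ∀ c : ℂ, D (algebraMap ℂ K c) = 0 := D.map_algebraMap
  have h2 : D (2 : K) = 0 := by rw [← map_ofNat (algebraMap ℂ K) 2]; exact hc 2
  have e1 := two_smul_sum_antisymm (fun j => algebraMap ℂ K (m j)) Z h.antisymm_Z (fun j => D (w j))
  have e2 := two_smul_sum_antisymm (fun j => algebraMap ℂ K (m j)) W h.antisymm_W (fun j => D (z j))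
  have e3 : D (∑ j, algebraMap ℂ K (m j) *
      (2 * z j * w j + algebraMap ℂ K η * (z j ^ 2 + w j ^ 2))) =
      (2 : K) • ∑ j, ∑ k, (algebraMap ℂ K (m j) * algebraMap ℂ K (m k) * Z k j) • D (w j) +
      (2 : K) • ∑ j, ∑ k, (algebraMap ℂ K (m j) * algebraMap ℂ K (m k) * W k j) • D (z j) := by
    rw [map_sum, ← smul_add, ← Finset.sum_add_distrib, Finset.smul_sum]
    refine Finset.sum_congr rfl fun j _ => ?_
    rw [← Finset.sum_smul, ← Finset.sum_smul]
    have f1 : ∑ k, algebraMap ℂ K (m j) * algebraMap ℂ K (m k) * Z k j =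
        algebraMap ℂ K (m j) * (z j + algebraMap ℂ K η * w j) := by
      rw [h.force_z, Finset.mul_sum]; exact Finset.sum_congr rfl fun k _ => by ring
    have f2 : ∑ k, algebraMap ℂ K (m j) * algebraMap ℂ K (m k) * W k j =
        algebraMap ℂ K (m j) * (w j + algebraMap ℂ K η * z j) := by
      rw [h.force_w, Finset.mul_sum]; exact Finset.sum_congr rfl fun k _ => by ring
    rw [f1, f2]
    simp only [Derivation.leibniz, map_add, hc, h2, pow_two, smul_zero, add_zero]
    module
  have e4 := congrArg D h.inertia_eq_potential
  have e5 : (2 : K) • ∑ j, ∑ k,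
        (algebraMap ℂ K (m j) * algebraMap ℂ K (m k) * Z k j) • D (w j) +
      (2 : K) • ∑ j, ∑ k, (algebraMap ℂ K (m j) * algebraMap ℂ K (m k) * W k j) • D (z j) =
      (-2 : K) • D (∑ j, ∑ k,
        algebraMap ℂ K (m j) * algebraMap ℂ K (m k) * (Z k j * (w j - w k))) := by
    rw [e1, e2, ← Finset.sum_add_distrib, map_sum, Finset.smul_sum]
    refine Finset.sum_congr rfl fun j _ => ?_
    rw [← Finset.sum_add_distrib, map_sum, Finset.smul_sum]
    refine Finset.sum_congr rfl fun k _ => ?_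
    have := h.derivation_inv_distance D k j
    rw [Derivation.leibniz D (algebraMap ℂ K (m j) * algebraMap ℂ K (m k)), Derivation.leibniz D
      (algebraMap ℂ K (m j)), hc, hc, smul_zero, smul_zero, add_zero, smul_zero, add_zero,
      smul_comm (-2 : K), neg_smul, ← this, map_sub, map_sub]
    module
  have e6 := e3.trans (e5.trans (by rw [← e4]))
  have h3 : IsUnit (3 : K) := by
    have := (IsUnit.mk0 (3 : ℂ) three_ne_zero).map (algebraMap ℂ K)
    rwa [map_ofNat] at this
  rw [← h3.smul_eq_zero, ← sub_eq_zero.mpr e6]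
  module

end SatisfiesBalancedEquations

/-! ### The complex variety and the real configurations -/

/-- An algebra homomorphism that kills the polynomials vanishing on a part of the variety maps the
coordinates to a solution of the balanced equations. -/
theorem satisfiesBalancedEquations_of_vanishingIdeal {η : ℝ} (hη₀ : 0 < η) (hη₁ : η < 1)
    {m : Fin 4 → ℝ} {S : Set ComplexPoint} (hS : S ⊆ balancedVariety η m)
    {K : Type*} [CommRing K] [Algebra ℂ K]
    (φ : MvPolynomial ((Fin 4 ⊕ (Fin 4 × Fin 4)) ⊕ (Fin 4 ⊕ (Fin 4 × Fin 4))) ℂ →ₐ[ℂ] K)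
    (hφ : ∀ p ∈ MvPolynomial.vanishingIdeal ℂ (ComplexPoint.coord '' S), φ p = 0) :
    SatisfiesBalancedEquations η m
      (fun j => φ (MvPolynomial.X (.inl (.inl j)))) (fun j => φ (MvPolynomial.X (.inr (.inl j))))
      (fun i j => φ (MvPolynomial.X (.inl (.inr (i, j)))))
      (fun i j => φ (MvPolynomial.X (.inr (.inr (i, j))))) := by
  have key : ∀ p q : MvPolynomial _ ℂ, (∀ Q ∈ S, SatisfiesBalancedEquations η m Q.z Q.w Q.Z Q.W →
      MvPolynomial.aeval Q.coord p = MvPolynomial.aeval Q.coord q) → φ p = φ q := by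
    intro p q h
    rw [← sub_eq_zero, ← map_sub]
    apply hφ
    rintro _ ⟨Q, hQ, rfl⟩
    rw [map_sub, sub_eq_zero]
    exact h Q hQ (satisfiesBalancedEquations_of_mem hη₀ hη₁ (hS hQ))
  have hC : ∀ c : ℂ, algebraMap ℂ K c = φ (MvPolynomial.C c) := fun c => (φ.commutes c).symm
  refine ⟨fun j => ?_, fun j => ?_, fun j => (key _ 0 fun Q _ h => ?_).trans (map_zero φ),
    fun j => (key _ 0 fun Q _ h => ?_).trans (map_zero φ), fun i j => ?_, fun i j => ?_,
    fun i j => ?_, fun i j hij => Eq.trans (b := φ 1) ?_ (map_one φ)⟩ <;>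
  (try simp only [hC, ← map_mul, ← map_add, ← map_sum, ← map_neg, ← map_sub, ← map_pow]) <;>
  (try refine key _ _ fun Q _ h => ?_) <;>
  simp only [map_mul, map_add, map_sum, map_neg, map_sub, map_pow, MvPolynomial.aeval_X, map_zero,
    map_one, MvPolynomial.aeval_C, ComplexPoint.coord, Sum.elim_inl, Sum.elim_inr]
  · exact h.force_z j
  · exact h.force_w j
  · exact h.diag_Z j
  · exact h.diag_W j
  · exact h.antisymm_Z i j
  · exact h.antisymm_W i j
  · exact h.cross i j
  · exact h.normalized i j hij

theorem ComplexPoint.two_mul_momentOfInertia (η : ℝ) (m : Fin 4 → ℝ) (Q : ComplexPoint) :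
    2 * Q.momentOfInertia η m =
      ∑ j, (m j : ℂ) * (2 * Q.z j * Q.w j + (η : ℂ) * (Q.z j ^ 2 + Q.w j ^ 2)) := by
  rw [ComplexPoint.momentOfInertia, Finset.mul_sum]
  refine Finset.sum_congr rfl fun j _ => ?_
  have h : ∀ x : ℂ, (x / (2 * Complex.I)) ^ 2 = -x ^ 2 / 4 := fun x => by
    rw [div_pow, mul_pow, Complex.I_sq]; ring
  rw [h]; ring

/-- Twice the moment of inertia, as a polynomial in the coordinates. -/
noncomputable def inertiaPolynomial (η : ℝ) (m : Fin 4 → ℝ) :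
    MvPolynomial ((Fin 4 ⊕ (Fin 4 × Fin 4)) ⊕ (Fin 4 ⊕ (Fin 4 × Fin 4))) ℂ :=
  ∑ j, MvPolynomial.C (m j : ℂ) *
    (2 * MvPolynomial.X (.inl (.inl j)) * MvPolynomial.X (.inr (.inl j)) + MvPolynomial.C (η : ℂ) *
      (MvPolynomial.X (.inl (.inl j)) ^ 2 + MvPolynomial.X (.inr (.inl j)) ^ 2))

theorem eval_inertiaPolynomial (η : ℝ) (m : Fin 4 → ℝ) (Q : ComplexPoint) :
    MvPolynomial.eval Q.coord (inertiaPolynomial η m) = 2 * Q.momentOfInertia η m := by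
  rw [Q.two_mul_momentOfInertia η m]
  simp only [inertiaPolynomial, map_sum, map_mul, map_add, map_pow, map_ofNat, MvPolynomial.eval_X,
    MvPolynomial.eval_C, ComplexPoint.coord, Sum.elim_inl, Sum.elim_inr]

/-- The moment of inertia takes finitely many values on the complex variety. -/
theorem finite_momentOfInertia_image {η : ℝ} (hη₀ : 0 < η) (hη₁ : η < 1) (m : Fin 4 → ℝ) :
    (ComplexPoint.momentOfInertia η m '' balancedVariety η m).Finite := by
  have hf := MvPolynomial.finite_values_of_kaehlerDifferential_eq_zero
    (ComplexPoint.coord '' balancedVariety η m) (inertiaPolynomial η m) (fun K _ _ φ hφ => by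
      have h := satisfiesBalancedEquations_of_vanishingIdeal hη₀ hη₁ subset_rfl φ hφ
      rw [← h.derivation_inertia_eq_zero (KaehlerDifferential.D ℂ K)]
      congr 1
      have hC : ∀ c : ℂ, φ (MvPolynomial.C c) = algebraMap ℂ K c := φ.commutes
      simp only [inertiaPolynomial, map_sum, map_mul, map_add, map_pow, map_ofNat, hC])
  rw [Set.image_image] at hf
  refine ((hf.image (fun c => c / 2))).subset ?_
  rintro _ ⟨Q, hQ, rfl⟩
  refine ⟨_, ⟨Q, hQ, rfl⟩, ?_⟩
  have e := eval_inertiaPolynomial η m Q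
  rw [← MvPolynomial.aeval_eq_eval] at e
  exact (congrArg (· / 2) e).trans
    (mul_div_cancel_left₀ _ two_ne_zero)

theorem ofReal_mem_balancedVariety {η : ℝ} (hη₀ : 0 < η) (hη₁ : η < 1) {m : Fin 4 → ℝ}
    {q : Fin 4 → EuclideanSpace ℝ (Fin 2)} (hq : q ∈ normalizedBalancedConfigurations η m) :
    ComplexPoint.ofReal q ∈ balancedVariety η m := by
  obtain ⟨hne, hbal⟩ := hq
  have hη := one_sub_sq_ne_zero hη₀ hη₁
  have hx : ∀ j, ((1 + η : ℝ) : ℂ) * (q j 0 : ℂ) =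
      ∑ k ∈ Finset.univ.erase j, (m k : ℂ) * ((((‖q k - q j‖ : ℝ) : ℂ) ^ 3)⁻¹ *
        ((q j 0 : ℂ) - (q k 0 : ℂ))) := by
    intro j
    have := congrArg (fun v : EuclideanSpace ℝ (Fin 2) => ((-v 0 : ℝ) : ℂ)) (hbal j)
    simp [balancedMatrix, Matrix.toLpLin_apply] at this
    push_cast
    rw [this, Finset.sum_erase _ (by simp), ← Finset.sum_neg_distrib]
    exact Finset.sum_congr rfl fun k _ => by ring
  have hy : ∀ j, ((1 - η : ℝ) : ℂ) * (q j 1 : ℂ) =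
      ∑ k ∈ Finset.univ.erase j, (m k : ℂ) * ((((‖q k - q j‖ : ℝ) : ℂ) ^ 3)⁻¹ *
        ((q j 1 : ℂ) - (q k 1 : ℂ))) := by
    intro j
    have := congrArg (fun v : EuclideanSpace ℝ (Fin 2) => ((-v 1 : ℝ) : ℂ)) (hbal j)
    simp [balancedMatrix, Matrix.toLpLin_apply] at this
    push_cast
    rw [this, Finset.sum_erase _ (by simp), ← Finset.sum_neg_distrib]
    exact Finset.sum_congr rfl fun k _ => by ring
  have hZ : ∀ j, ∑ k ∈ Finset.univ.erase j, (m k : ℂ) * (ComplexPoint.ofReal q).Z k j =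
      ((1 + η : ℝ) : ℂ) * (q j 0 : ℂ) + Complex.I * (((1 - η : ℝ) : ℂ) * (q j 1 : ℂ)) := by
    intro j
    rw [hx, hy, Finset.mul_sum, ← Finset.sum_add_distrib]
    exact Finset.sum_congr rfl fun k _ => by simp only [ComplexPoint.ofReal]; ring
  have hW : ∀ j, ∑ k ∈ Finset.univ.erase j, (m k : ℂ) * (ComplexPoint.ofReal q).W k j =
      ((1 + η : ℝ) : ℂ) * (q j 0 : ℂ) - Complex.I * (((1 - η : ℝ) : ℂ) * (q j 1 : ℂ)) := by
    intro j
    rw [hx, hy, Finset.mul_sum, ← Finset.sum_sub_distrib]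
    exact Finset.sum_congr rfl fun k _ => by simp only [ComplexPoint.ofReal]; ring
  refine ⟨⟨fun i j => ((‖q i - q j‖ : ℝ) : ℂ), fun i j => ?_, fun i j hij => ?_, fun i j => ?_,
    fun i j => rfl, fun i j => rfl⟩, fun j => ?_, fun j => ?_⟩
  · simp only [norm_sub_rev]
  · simpa [sub_eq_zero] using hne i j hij
  · have : ‖q i - q j‖ ^ 2 = (q i 0 - q j 0) ^ 2 + (q i 1 - q j 1) ^ 2 := by
      rw [EuclideanSpace.norm_sq_eq]; simp
    rw [← Complex.ofReal_pow, this]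
    simp only [ComplexPoint.ofReal]
    push_cast
    linear_combination (((q j 1 : ℂ) - (q i 1 : ℂ)) ^ 2) * Complex.I_sq
  · rw [hZ, hW]; simp only [ComplexPoint.ofReal]; push_cast; field_simp; ring
  · rw [hZ, hW]; simp only [ComplexPoint.ofReal]; push_cast; field_simp; ring

theorem momentOfInertia_ofReal_ne_zero {η : ℝ} (hη₀ : 0 < η) (hη₁ : η < 1) {m : Fin 4 → ℝ}
    (hm : ∀ j, 0 < m j) {q : Fin 4 → EuclideanSpace ℝ (Fin 2)}
    (hq : q ∈ normalizedBalancedConfigurations η m) :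
    (ComplexPoint.ofReal q).momentOfInertia η m ≠ 0 := by
  have h1 : (ComplexPoint.ofReal q).momentOfInertia η m =
      ((∑ j, m j * ((1 + η) * (q j 0) ^ 2 + (1 - η) * (q j 1) ^ 2) : ℝ) : ℂ) := by
    rw [ComplexPoint.momentOfInertia]
    push_cast
    refine Finset.sum_congr rfl fun j _ => ?_
    simp only [ComplexPoint.ofReal]
    have : ((q j 0 : ℂ) + Complex.I * (q j 1 : ℂ) - ((q j 0 : ℂ) - Complex.I * (q j 1 : ℂ))) /
        (2 * Complex.I) = (q j 1 : ℂ) := by field_simp [Complex.I_ne_zero]; ring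
    rw [this]; ring
  rw [h1, Ne, Complex.ofReal_eq_zero]
  intro h0
  rw [Finset.sum_eq_zero_iff_of_nonneg fun j _ => mul_nonneg (hm j).le (by
    have := sub_pos.mpr hη₁; positivity)] at h0
  have hz : ∀ j, q j = 0 := by
    intro j
    have h2 := (mul_eq_zero.mp (h0 j (Finset.mem_univ j))).resolve_left (hm j).ne'
    have h3 := sub_pos.mpr hη₁
    have h4 : q j 0 ^ 2 = 0 := by nlinarith [sq_nonneg (q j 0), sq_nonneg (q j 1)]
    have h5 : q j 1 ^ 2 = 0 := by nlinarith [sq_nonneg (q j 0), sq_nonneg (q j 1)]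
    ext i
    fin_cases i
    · simpa using h4
    · simpa using h5
  exact hq.1 0 1 (by decide) (by rw [hz, hz])

/-- On the Zariski closure of the real configurations the moment of inertia is not zero, since it
has finitely many values at the real configurations, none of them zero. -/
theorem momentOfInertia_ne_zero_of_mem_real {η : ℝ} (hη₀ : 0 < η) (hη₁ : η < 1) {m : Fin 4 → ℝ}
    (hm : ∀ j, 0 < m j) {Q : ComplexPoint} (hQ : Q ∈ realBalancedVariety η m) :
    Q.momentOfInertia η m ≠ 0 := by
  classical
  intro h0
  let T := (finite_momentOfInertia_image hη₀ hη₁ m).toFinset.erase 0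
  have := hQ.2 (∏ c ∈ T, (inertiaPolynomial η m - MvPolynomial.C (2 * c))) (fun q hq => by
    rw [map_prod]
    refine Finset.prod_eq_zero (i := (ComplexPoint.ofReal q).momentOfInertia η m) ?_ ?_
    · refine Finset.mem_erase.mpr ⟨momentOfInertia_ofReal_ne_zero hη₀ hη₁ hm hq, ?_⟩
      exact (Set.Finite.mem_toFinset _).mpr ⟨_, ofReal_mem_balancedVariety hη₀ hη₁ hq, rfl⟩
    · rw [map_sub, eval_inertiaPolynomial, MvPolynomial.eval_C, sub_self])
  rw [map_prod, Finset.prod_eq_zero_iff] at this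
  obtain ⟨c, hc, hc'⟩ := this
  rw [map_sub, eval_inertiaPolynomial, h0, MvPolynomial.eval_C] at hc'
  refine (Finset.mem_erase.mp hc).1 ?_
  simpa using hc'

theorem ComplexPoint.norm_coord_le (Q : ComplexPoint) (i) :
    ‖Q.coord i‖ ≤ max Q.normZ Q.normW := by
  rcases i with (j | ⟨i, j⟩) | (j | ⟨i, j⟩)
  · exact le_max_of_le_left ((norm_le_pi_norm Q.z j).trans (norm_fst_le (Q.z, Q.Z)))
  · exact le_max_of_le_left (((norm_le_pi_norm (Q.Z i) j).trans (norm_le_pi_norm Q.Z i)).trans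
      (norm_snd_le (Q.z, Q.Z)))
  · exact le_max_of_le_right ((norm_le_pi_norm Q.w j).trans (norm_fst_le (Q.w, Q.W)))
  · exact le_max_of_le_right (((norm_le_pi_norm (Q.W i) j).trans (norm_le_pi_norm Q.W i)).trans
      (norm_snd_le (Q.w, Q.W)))

/-- If there are infinitely many normalized configurations, their Zariski closure is an infinite
closed set, hence unbounded. -/
theorem exists_isSingularSequence_of_infinite {η : ℝ} (hη₀ : 0 < η) (hη₁ : η < 1) {m : Fin 4 → ℝ}
    (hinf : (normalizedBalancedConfigurations η m).Infinite) :
    ∃ Q : ℕ → ComplexPoint, IsSingularSequence (realBalancedVariety η m) Q := by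
  let S := ComplexPoint.ofReal '' normalizedBalancedConfigurations η m
  have hS : S ⊆ balancedVariety η m := by
    rintro _ ⟨q, hq, rfl⟩; exact ofReal_mem_balancedVariety hη₀ hη₁ hq
  let J := MvPolynomial.vanishingIdeal ℂ (ComplexPoint.coord '' S)
  have hSJ : (ComplexPoint.coord '' S) ⊆ MvPolynomial.zeroLocus ℂ J :=
    MvPolynomial.zeroLocus_vanishingIdeal_le _
  have hinj : Function.Injective fun q => (ComplexPoint.ofReal q).coord := by
    intro q q' h
    have h1 := fun j => congrFun h (.inl (.inl j))
    have h2 := fun j => congrFun h (.inr (.inl j))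
    simp only [ComplexPoint.coord, ComplexPoint.ofReal, Sum.elim_inl, Sum.elim_inr] at h1 h2
    ext j i
    fin_cases i
    · have := congrArg Complex.re (h1 j); simpa using this
    · have := congrArg Complex.im (h1 j); simpa using this
  have hunb : ¬ Bornology.IsBounded (MvPolynomial.zeroLocus ℂ J) := by
    intro hb
    have hfin := (MvPolynomial.finite_zeroLocus_of_isBounded J hb).subset hSJ
    rw [Set.image_image] at hfin
    exact hinf (hfin.of_finite_image hinj.injOn)
  have hex : ∀ n : ℕ, ∃ Q ∈ realBalancedVariety η m, (n : ℝ) ≤ max Q.normZ Q.normW := by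
    intro n
    by_contra hcon
    push Not at hcon
    refine hunb ((Metric.isBounded_closedBall (x := 0) (r := (n : ℝ))).subset fun x hx => ?_)
    let Q : ComplexPoint := ⟨fun j => x (.inl (.inl j)), fun i j => x (.inl (.inr (i, j))),
      fun j => x (.inr (.inl j)), fun i j => x (.inr (.inr (i, j)))⟩
    have hQx : Q.coord = x := by
      ext i
      rcases i with (j | ⟨i, j⟩) | (j | ⟨i, j⟩) <;> rfl
    have hQ : Q ∈ realBalancedVariety η m := by
      refine ⟨mem_balancedVariety_of_satisfies hη₀ hη₁ ?_, fun P hP => ?_⟩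
      · have := satisfiesBalancedEquations_of_vanishingIdeal hη₀ hη₁ hS (MvPolynomial.aeval x) hx
        simpa [Q] using this
      · rw [hQx, ← MvPolynomial.aeval_eq_eval]
        refine hx P ?_
        rintro _ ⟨_, ⟨q, hq, rfl⟩, rfl⟩
        exact hP q hq
    rw [mem_closedBall_zero_iff, pi_norm_le_iff_of_nonneg (Nat.cast_nonneg n)]
    intro i
    rw [← hQx]
    exact (Q.norm_coord_le i).trans (hcon Q hQ).le
  choose Q hQ hQn using hex
  exact ⟨Q, hQ, tendsto_atTop_mono hQn tendsto_natCast_atTop_atTop⟩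

/-! ### Class averages and mass conditions -/

open Classical in
/-- Linear relations between the limits `ζ`, `ω` of the rescaled positions, when the bodies joined by
strokes of each colour form the classes of `Rz` and `Rw`. Each of the two families says that
`-η` times one vector is the mass-weighted average of the other one over the classes. -/
structure ClassRelations (η : ℝ) (m : Fin 4 → ℝ) (ζ ω : Fin 4 → ℂ)
    (Rz Rw : Fin 4 → Fin 4 → Prop) : Prop where
  equiv_z : Equivalence Rz
  equiv_w : Equivalence Rw
  const_w : ∀ i j, Rz i j → ω i = ω j
  const_z : ∀ i j, Rw i j → ζ i = ζ j
  sum_z : ∀ i, ∑ j, (if Rz i j then (m j : ℂ) * (ζ j + η * ω j) else 0) = 0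
  sum_w : ∀ i, ∑ j, (if Rw i j then (m j : ℂ) * (ω j + η * ζ j) else 0) = 0

theorem ClassRelations.swap {η : ℝ} {m : Fin 4 → ℝ} {ζ ω : Fin 4 → ℂ}
    {Rz Rw : Fin 4 → Fin 4 → Prop} (h : ClassRelations η m ζ ω Rz Rw) :
    ClassRelations η m ω ζ Rw Rz :=
  ⟨h.equiv_w, h.equiv_z, h.const_z, h.const_w, h.sum_w, h.sum_z⟩

open Classical in
/-- A function that is constant on the class of `i` and has mass-weighted sum zero over it vanishes
at `i`. -/
theorem eq_zero_of_const_on_class {m : Fin 4 → ℝ} (hm : ∀ j, 0 < m j)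
    {R : Fin 4 → Fin 4 → Prop} (i : Fin 4) (hi : R i i) {c : Fin 4 → ℂ}
    (hc : ∀ j, R i j → c j = c i) (hsum : ∑ j, (if R i j then (m j : ℂ) * c j else 0) = 0) :
    c i = 0 := by
  have h1 : ∑ j, (if R i j then (m j : ℂ) * c j else 0) =
      ((∑ j, (if R i j then m j else 0) : ℝ) : ℂ) * c i := by
    push_cast
    rw [Finset.sum_mul]
    refine Finset.sum_congr rfl fun j _ => ?_
    split_ifs with hj
    · rw [hc j hj]
    · simp
  rw [hsum] at h1
  refine (mul_eq_zero.mp h1.symm).resolve_left ?_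
  rw [Complex.ofReal_eq_zero]
  refine (Finset.sum_pos' (fun j _ => ?_) ⟨i, Finset.mem_univ i, ?_⟩).ne'
  · split_ifs; exacts [(hm j).le, le_rfl]
  · rw [if_pos hi]; exact hm i

theorem ClassRelations.flat_z {η : ℝ} {m : Fin 4 → ℝ} (hm : ∀ j, 0 < m j) {ζ ω : Fin 4 → ℂ}
    {Rz Rw : Fin 4 → Fin 4 → Prop} (h : ClassRelations η m ζ ω Rz Rw) (i : Fin 4)
    (hi : ∀ j, Rz i j → ζ i = ζ j) : ζ i + η * ω i = 0 :=
  eq_zero_of_const_on_class hm (c := fun j => ζ j + η * ω j) i (h.equiv_z.refl i)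
    (fun j hj => by rw [hi j hj, h.const_w i j hj]) (h.sum_z i)

/-- Unless both limits vanish, some body `j` has a companion `i` in its first class and a companion
`k` in its second class from both of which it is separated. Otherwise each body would satisfy
`ζ = -η ω` or `ω = -η ζ`, and the same one for companions, which forces `ζ = ω = 0`. -/
theorem ClassRelations.exists_separated {η : ℝ} (hη₀ : 0 < η) (hη₁ : η < 1) {m : Fin 4 → ℝ}
    (hm : ∀ j, 0 < m j) {ζ ω : Fin 4 → ℂ} {Rz Rw : Fin 4 → Fin 4 → Prop}
    (h : ClassRelations η m ζ ω Rz Rw) (hne : ¬ (ζ = 0 ∧ ω = 0)) :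
    ∃ i j k, Rz i j ∧ ζ i ≠ ζ j ∧ Rw j k ∧ ω j ≠ ω k := by
  by_contra hcon
  push Not at hcon
  have hη : (η : ℂ) ≠ 0 := by exact_mod_cast hη₀.ne'
  have key : ∀ (ζ ω : Fin 4 → ℂ) (Rz Rw : Fin 4 → Fin 4 → Prop),
      ClassRelations η m ζ ω Rz Rw →
      (∀ i j k, Rz i j → ζ i ≠ ζ j → Rw j k → ω j = ω k) → ∀ j k, Rw j k → ω j = ω k := by
    intro ζ ω Rz Rw h hcon j k hjk
    by_contra hω
    have hj := h.flat_z hm j (fun i hi => by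
      by_contra hz
      exact hω (hcon i j k (h.equiv_z.symm hi) (Ne.symm hz) hjk))
    have hk := h.flat_z hm k (fun i hi => by
      by_contra hz
      exact hω (hcon i k j (h.equiv_z.symm hi) (Ne.symm hz) (h.equiv_w.symm hjk)).symm)
    have hz := h.const_z j k hjk
    refine hω (mul_left_cancel₀ hη ?_)
    linear_combination hj - hk - hz
  have hw := key ζ ω Rz Rw h hcon
  have hz := key ω ζ Rw Rz h.swap fun i j k h1 h2 h3 => by
    by_contra h4
    exact h2 (hcon k j i (h.equiv_z.symm h3) (Ne.symm h4) (h.equiv_w.symm h1)).symm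
  have hη2 := one_sub_sq_ne_zero hη₀ hη₁
  have e1 : ∀ j, ζ j = 0 := fun j => by
    have h1 := h.flat_z hm j (hz j)
    have h2 := h.swap.flat_z hm j (hw j)
    refine (mul_eq_zero.mp ?_).resolve_left hη2
    linear_combination h1 - (η : ℂ) * h2
  have e2 : ∀ j, ω j = 0 := fun j => by
    have h2 := h.swap.flat_z hm j (hw j)
    rw [e1] at h2; simpa using h2
  exact hne ⟨funext e1, funext e2⟩

/-- Elimination for two overlapping classes when the rest of the bodies does not interfere: `a` and
`c` are the total masses of the parts outside the overlap, `b` is that of the overlap. -/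
theorem massRelation_of_chain {η : ℝ} (hη₀ : 0 < η) (hη₁ : η < 1) {a b c : ℝ} {x y u v : ℂ}
    (huv : u ≠ v) (h1 : (a : ℂ) * (v + η * x) + b * (u + η * x) = 0) (h2 : u + η * y = 0)
    (h3 : (b : ℂ) * (x + η * u) + c * (y + η * u) = 0) (h4 : x + η * v = 0) :
    η ^ 2 * (a + b) * (b + c) = a * c := by
  have hη := one_sub_sq_ne_zero hη₀ hη₁
  have hu : u = -(η * y) := by linear_combination h2
  have hx : x = -(η * v) := by linear_combination h4
  subst hu hx
  have e1 : ((1 - (η : ℂ) ^ 2) * (a * c - η ^ 2 * (a + b) * (b + c))) * v = 0 := by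
    linear_combination ((c : ℂ) * (1 - η ^ 2) - b * η ^ 2) * h1 + b * η * h3
  have e2 : ((1 - (η : ℂ) ^ 2) * (a * c - η ^ 2 * (a + b) * (b + c))) * y = 0 := by
    linear_combination ((a : ℂ) * (1 - η ^ 2) - b * η ^ 2) * h3 + b * η * h1
  have e3 : ((a : ℂ) * c - η ^ 2 * (a + b) * (b + c)) = 0 := by
    by_contra h0
    have h5 := (mul_eq_zero.mp e1).resolve_left (mul_ne_zero hη h0)
    have h6 := (mul_eq_zero.mp e2).resolve_left (mul_ne_zero hη h0)
    exact huv (by rw [h5, h6]; simp)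
  have e4 : a * c - η ^ 2 * (a + b) * (b + c) = 0 := by exact_mod_cast e3
  linarith

/-- Elimination when one colour has two classes of two bodies and the other one a single pair. -/
theorem massConditionV2_of_classes {η : ℝ} (hη₀ : 0 < η) (hη₁ : η < 1) {a b c d : ℝ}
    (hb : 0 < b) (hc : 0 < c) (hd : 0 < d) {x y u v q : ℂ} (huv : u ≠ v)
    (h1 : (a : ℂ) * (v + η * x) + b * (u + η * x) = 0)
    (h2 : (c : ℂ) * (u + η * y) + d * (q + η * y) = 0)
    (h3 : (b : ℂ) * (x + η * u) + c * (y + η * u) = 0) (h4 : x + η * v = 0) (h5 : y + η * q = 0) :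
    MassConditionV2 η a b c d := by
  have hη : (η : ℂ) ≠ 0 := by exact_mod_cast hη₀.ne'
  have hx : x = -(η * v) := by linear_combination h4
  have hy : y = -(η * q) := by linear_combination h5
  subst hx hy
  have e3 : (b : ℂ) * (u - v) + c * (u - q) = 0 := by
    refine (mul_eq_zero.mp ?_).resolve_left hη
    linear_combination h3
  have hcd : (c : ℂ) + d ≠ 0 := by exact_mod_cast (add_pos hc hd).ne'
  have hbc : (b : ℂ) + c ≠ 0 := by exact_mod_cast (add_pos hb hc).ne'
  have e0 : (1 - (η : ℂ) ^ 2) * ((a + b) * v + (c + d) * q) = 0 := by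
    linear_combination h1 + h2 - e3
  have hv : v ≠ 0 := by
    intro hv
    subst hv
    have k1 : (b : ℂ) * u = 0 := by linear_combination h1
    have hu : u = 0 := (mul_eq_zero.mp k1).resolve_left (by exact_mod_cast hb.ne')
    exact huv hu
  have e4 : (((b : ℂ) + c) * (a + b) * (c + d) * (1 - η ^ 2) - b * c * (a + b + c + d)) *
      (1 - (η : ℂ) ^ 2) * v = 0 := by
    linear_combination (1 - (η : ℂ) ^ 2) * ((b + c) * (c + d) * h1 - b * (c + d) * e3) -
      b * c * e0
  have e5 := (mul_eq_zero.mp ((mul_eq_zero.mp e4).resolve_right hv)).resolve_right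
    (one_sub_sq_ne_zero hη₀ hη₁)
  have e6 : (b + c) * (a + b) * (c + d) * (1 - η ^ 2) - b * c * (a + b + c + d) = 0 := by
    exact_mod_cast e5
  have hbc' : b + c ≠ 0 := (add_pos hb hc).ne'
  unfold MassConditionV2
  field_simp
  linear_combination (a + b + c + d) * e6

/-- Elimination when both colours have two classes of two bodies. -/
theorem massConditionII_of_classes {η : ℝ} (hη₀ : 0 < η) (hη₁ : η < 1) {a b c d : ℝ}
    (hb : 0 < b) (hc : 0 < c) {x y u v : ℂ} (huv : u ≠ v)
    (h1 : (a : ℂ) * (v + η * x) + b * (u + η * x) = 0)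
    (h2 : (c : ℂ) * (u + η * y) + d * (v + η * y) = 0)
    (h3 : (b : ℂ) * (x + η * u) + c * (y + η * u) = 0)
    (h4 : (a : ℂ) * (x + η * v) + d * (y + η * v) = 0) :
    MassConditionII η b a c d := by
  have hη := one_sub_sq_ne_zero hη₀ hη₁
  have s1 : ((a : ℂ) + d) * v + (b + c) * u = 0 := by
    refine (mul_eq_zero.mp ?_).resolve_left hη
    linear_combination h1 + h2 - (η : ℂ) * (h3 + h4)
  have s2 : ((a : ℂ) + b) * x + (c + d) * y = 0 := by
    refine (mul_eq_zero.mp ?_).resolve_left hη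
    linear_combination h3 + h4 - (η : ℂ) * (h1 + h2)
  have hbc : (b : ℂ) + c ≠ 0 := by exact_mod_cast (add_pos hb hc).ne'
  have hv : v ≠ 0 := by
    intro hv
    subst hv
    have k1 : ((b : ℂ) + c) * u = 0 := by linear_combination s1
    exact huv ((mul_eq_zero.mp k1).resolve_left hbc)
  have e1 : ((a : ℂ) * c - b * d) * v = -(η * (a + b) * (b + c)) * x := by
    linear_combination (b + c) * h1 - b * s1
  have e2 : ((b : ℂ) * d - a * c) * x = -(η * (c + d) * (b + c)) * u := by
    linear_combination (c + d) * h3 - c * s2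
  have e3 : (((b : ℂ) * d - a * c) ^ 2 - η ^ 2 * (b + a) * (c + d) * (b + c) * (a + d)) * v = 0 := by
    linear_combination (a * c - b * d : ℂ) * e1 + η * (a + b) * (b + c) * e2 -
      η ^ 2 * (a + b) * (c + d) * (b + c) * s1
  have e4 := (mul_eq_zero.mp e3).resolve_right hv
  have e5 : (b * d - a * c) ^ 2 - η ^ 2 * (b + a) * (c + d) * (b + c) * (a + d) = 0 := by
    exact_mod_cast e4
  unfold MassConditionII
  linarith

theorem sum_eq_of_distinct {M : Type*} [AddCommMonoid M] {i j k l : Fin 4} (hij : i ≠ j)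
    (hik : i ≠ k) (hil : i ≠ l) (hjk : j ≠ k) (hjl : j ≠ l) (hkl : k ≠ l) (f : Fin 4 → M) :
    ∑ n, f n = f i + f j + f k + f l := by
  have hu : (Finset.univ : Finset (Fin 4)) = {i, j, k, l} := by decide +revert
  rw [hu, Finset.sum_insert (by simp [*]), Finset.sum_insert (by simp [*]),
    Finset.sum_insert (by simp [*]), Finset.sum_singleton, add_assoc, add_assoc]

theorem exists_perm_of_distinct {i j k l : Fin 4} (hij : i ≠ j)
    (hik : i ≠ k) (hil : i ≠ l) (hjk : j ≠ k) (hjl : j ≠ l) (hkl : k ≠ l) :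
    ∃ σ : Equiv.Perm (Fin 4), σ 0 = i ∧ σ 1 = j ∧ σ 2 = k ∧ σ 3 = l := by
  have hinj : Function.Injective ![i, j, k, l] := by
    intro a b hab
    fin_cases a <;> fin_cases b <;> simp_all
  exact ⟨Equiv.ofBijective _ (Finite.injective_iff_bijective.mp hinj), rfl, rfl, rfl, rfl⟩

theorem exists_fourth (i j k : Fin 4) : ∃ l, i ≠ l ∧ j ≠ l ∧ k ≠ l := by
  decide +revert

/-- The balance of one colour when `i` and `j` are companions and `k` is not: the fourth body `l`
is alone, or with `i` and `j`, or with `k`. -/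
theorem ClassRelations.balance_z {η : ℝ} {m : Fin 4 → ℝ} (hm : ∀ j, 0 < m j) {ζ ω : Fin 4 → ℂ}
    {Rz Rw : Fin 4 → Fin 4 → Prop} (h : ClassRelations η m ζ ω Rz Rw) {i j k l : Fin 4}
    (hij : i ≠ j) (hik : i ≠ k) (hil : i ≠ l) (hjk : j ≠ k) (hjl : j ≠ l) (hkl : k ≠ l)
    (hR : Rz i j) (hω : ω j ≠ ω k) :
    ((m i : ℂ) * (ζ i + η * ω i) + m j * (ζ j + η * ω j) = 0 ∧ ζ k + η * ω k = 0 ∧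
      ζ l + η * ω l = 0) ∨
    (Rz i l ∧ ω l = ω j ∧ (m i : ℂ) * (ζ i + η * ω i) + m j * (ζ j + η * ω j) +
      m l * (ζ l + η * ω l) = 0 ∧ ζ k + η * ω k = 0) ∨
    (ω l = ω k ∧ (m i : ℂ) * (ζ i + η * ω i) + m j * (ζ j + η * ω j) = 0 ∧
      (m k : ℂ) * (ζ k + η * ω k) + m l * (ζ l + η * ω l) = 0) := by
  classical
  have hsum := fun f : Fin 4 → ℂ => sum_eq_of_distinct hij hik hil hjk hjl hkl f
  have hs := h.sum_z
  simp only [hsum] at hs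
  have hr := h.equiv_z.refl
  have hs' : ∀ {a b}, Rz a b → Rz b a := h.equiv_z.symm
  have ht : ∀ {a b c}, Rz a b → Rz b c → Rz a c := h.equiv_z.trans
  have nik : ¬ Rz i k := fun hc => hω (h.const_w _ _ (ht (hs' hR) hc))
  have nki : ¬ Rz k i := fun hc => nik (hs' hc)
  have nkj : ¬ Rz k j := fun hc => nki (ht hc (hs' hR))
  have hmk : ∀ n, (m n : ℂ) ≠ 0 := fun n => by exact_mod_cast (hm n).ne'
  have h_i := hs i
  have h_k := hs k
  have h_l := hs l
  by_cases hl1 : Rz i l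
  · have nkl : ¬ Rz k l := fun hc => nki (ht hc (hs' hl1))
    simp only [hr, hR, nik, nki, nkj, hl1, nkl, if_true, if_false, add_zero, zero_add, mul_eq_zero,
      hmk, false_or] at h_i h_k
    exact .inr (.inl ⟨hl1, (h.const_w _ _ (ht (hs' hR) hl1)).symm, h_i, h_k⟩)
  · by_cases hl2 : Rz k l
    · simp only [hr, hR, nik, nki, nkj, hl1, hl2, if_true, if_false, add_zero, zero_add] at h_i h_k
      exact .inr (.inr ⟨(h.const_w _ _ hl2).symm, h_i, h_k⟩)
    · have nli : ¬ Rz l i := fun hc => hl1 (hs' hc)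
      have nlj : ¬ Rz l j := fun hc => nli (ht hc (hs' hR))
      have nlk : ¬ Rz l k := fun hc => hl2 (hs' hc)
      simp only [hr, hR, nik, nki, nkj, hl1, hl2, nli, nlj, nlk, if_true, if_false, add_zero,
        zero_add, mul_eq_zero, hmk, false_or] at h_i h_k h_l
      exact .inl ⟨h_i, h_k, h_l⟩

/-- For masses that are not exceptional, limits that are not both zero occur only if the classes are
`{i, j, l}`, `{k}` for one colour and `{j, k, l}`, `{i}` for the other one. -/
theorem ClassRelations.exists_overlapping_triples {η : ℝ} (hη₀ : 0 < η) (hη₁ : η < 1)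
    {m : Fin 4 → ℝ} (hm : ∀ j, 0 < m j) (hM : m ∉ exceptionalMasses η) {ζ ω : Fin 4 → ℂ}
    {Rz Rw : Fin 4 → Fin 4 → Prop} (h : ClassRelations η m ζ ω Rz Rw) (hne : ¬ (ζ = 0 ∧ ω = 0)) :
    ∃ i j k l, i ≠ j ∧ i ≠ k ∧ i ≠ l ∧ j ≠ k ∧ j ≠ l ∧ k ≠ l ∧
      Rz i j ∧ Rz i l ∧ Rw k j ∧ Rw k l ∧ ζ i ≠ ζ j ∧ ω j ≠ ω k := by
  obtain ⟨i, j, k, hz, hζ, hw, hω⟩ := h.exists_separated hη₀ hη₁ hm hne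
  have hij : i ≠ j := fun e => hζ (by rw [e])
  have hjk : j ≠ k := fun e => hω (by rw [e])
  have ekj := h.const_z j k hw
  have eij := h.const_w i j hz
  have hik : i ≠ k := fun e => hζ (by rw [e, ekj])
  obtain ⟨l, hil, hjl, hkl⟩ : ∃ l, i ≠ l ∧ j ≠ l ∧ k ≠ l := exists_fourth i j k
  have hη : (η : ℂ) ≠ 0 := by exact_mod_cast hη₀.ne'
  have perm : ∀ {a b c d : Fin 4}, a ≠ b → a ≠ c → a ≠ d → b ≠ c → b ≠ d → c ≠ d → ¬
      (MassConditionII η (m a) (m b) (m c) (m d) ∨ MassConditionIII η (m a) (m b) (m c) ∨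
      MassConditionIV η (m a) (m b) (m c) (m d) ∨ MassConditionV2 η (m a) (m b) (m c) (m d) ∨
      MassConditionVI η (m a) (m b) (m c) (m d) ∨ MassConditionVIII (m a) (m b) (m c)) := by
    intro a b c d h1 h2 h3 h4 h5 h6 hcon
    obtain ⟨σ, rfl, rfl, rfl, rfl⟩ := exists_perm_of_distinct h1 h2 h3 h4 h5 h6
    exact hM ⟨σ, hcon⟩
  have bz := h.balance_z hm hij hik hil hjk hjl hkl hz hω
  have bw := h.swap.balance_z hm hjk.symm hik.symm hkl hij.symm hjl hil (h.equiv_w.symm hw) hζ.symm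
  rw [eij, ← ekj] at bz
  rw [eij, ← ekj] at bw
  have hadd : ∀ a b : Fin 4, (m a : ℂ) + m b ≠ 0 := fun a b => by
    exact_mod_cast (add_pos (hm a) (hm b)).ne'
  -- Two overlapping pairs, one of them enlarged by the fourth body: condition VI.
  have chain_k : ζ j + η * ω k = 0 → ω i + η * ζ i = 0 →
      (m i : ℂ) * (ζ i + η * ω j) + m j * (ζ j + η * ω j) = 0 →
      (m j : ℂ) * (ω j + η * ζ j) + (m k + m l : ℝ) * (ω k + η * ζ j) = 0 → False := by
    intro e1 e2 e3 e4
    have := massRelation_of_chain hη₀ hη₁ hζ.symm e3 e1 e4 (by rw [← eij]; exact e2)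
    refine perm hik hij hil hjk.symm hkl hjl (.inr (.inr (.inr (.inr (.inl ?_)))))
    unfold MassConditionVI
    linarith
  have chain_i : ζ j + η * ω k = 0 → ω j + η * ζ i = 0 →
      ((m i + m l : ℝ) : ℂ) * (ζ i + η * ω j) + m j * (ζ j + η * ω j) = 0 →
      (m j : ℂ) * (ω j + η * ζ j) + m k * (ω k + η * ζ j) = 0 → False := by
    intro e1 e2 e3 e4
    have := massRelation_of_chain hη₀ hη₁ hζ.symm e3 e1 e4 e2
    refine perm hik.symm hjk.symm hkl hij hil hjl (.inr (.inr (.inr (.inr (.inl ?_)))))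
    unfold MassConditionVI
    linarith
  rcases bz with ⟨z1, z2, z3⟩ | ⟨zl, z0, z1, z2⟩ | ⟨z0, z1, z2⟩ <;>
  rcases bw with ⟨w1, w2, w3⟩ | ⟨wl, w0, w1, w2⟩ | ⟨w0, w1, w2⟩
  · have := massRelation_of_chain hη₀ hη₁ (a := m i) (b := m j) (c := m k) hζ.symm z1 z2
      (by linear_combination w1) w2
    exact absurd (.inr (.inl this)) (perm hij hik hil hjk hjl hkl)
  · have hp : ω l = ω k := mul_left_cancel₀ hη (by linear_combination z3 - z2 - w0)
    refine (chain_k z2 (by rw [eij]; exact w2) z1 ?_).elim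
    push_cast
    linear_combination w1 - (m l : ℂ) * hp - (m l : ℂ) * η * w0
  · have := massConditionV2_of_classes hη₀ hη₁ (a := m k) (hm j) (hm i) (hm l) (x := ζ j)
      (y := ζ i) (u := ω j) (v := ω k) (q := ω l) hω w1 (by rw [w0] at w2; exact w2) (by linear_combination z1) z2
      (by linear_combination z3 - w0)
    exact absurd (.inr (.inr (.inr (.inl this)))) (perm hjk.symm hik.symm hkl hij.symm hjl hil)
  · have hp : ζ l = ζ i := mul_left_cancel₀ hη (by linear_combination w3 - w2 - z0)
    refine (chain_i z2 w2 ?_ (by linear_combination w1)).elim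
    push_cast
    linear_combination z1 - (m l : ℂ) * hp - (m l : ℂ) * η * z0
  · exact ⟨i, j, k, l, hij, hik, hil, hjk, hjl, hkl, hz, zl, h.equiv_w.symm hw, wl, hζ, hω⟩
  · rw [w0, z0] at w2
    have w3 : ω j + η * ζ i = 0 :=
      (mul_eq_zero.mp (by linear_combination w2)).resolve_left (hadd i l)
    refine (chain_i z2 w3 ?_ (by linear_combination w1)).elim
    push_cast
    linear_combination z1 - (m l : ℂ) * w0 - (m l : ℂ) * η * z0
  · have := massConditionV2_of_classes hη₀ hη₁ (a := m i) (hm j) (hm k) (hm l) (x := ω j)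
      (y := ω k) (u := ζ j) (v := ζ i) (q := ζ l) hζ.symm z1 (by rw [z0] at z2; exact z2)
      (by linear_combination w1) w2 (by linear_combination w3 - z0)
    exact absurd (.inr (.inr (.inr (.inl this)))) (perm hij hik hil hjk hjl hkl)
  · rw [w0, z0] at z2
    have z3 : ζ j + η * ω k = 0 :=
      (mul_eq_zero.mp (by linear_combination z2)).resolve_left (hadd k l)
    refine (chain_k z3 (by rw [eij]; exact w2) z1 ?_).elim
    push_cast
    linear_combination w1 - (m l : ℂ) * z0 - (m l : ℂ) * η * w0
  · have := massConditionII_of_classes hη₀ hη₁ (a := m i) (hm j) (hm k) (d := m l) hζ.symm z1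
      (by rw [z0, w0] at z2; exact z2) (by linear_combination w1) (by rw [z0, w0] at w2; exact w2)
    exact absurd (.inl this) (perm hij.symm hjk hjl hik hil hkl)

/-! ### Rescaled limits -/

theorem SatisfiesBalancedEquations.swap {K : Type*} [CommRing K] [Algebra ℂ K] {η : ℝ}
    {m : Fin 4 → ℝ} {z w : Fin 4 → K} {Z W : Fin 4 → Fin 4 → K}
    (h : SatisfiesBalancedEquations η m z w Z W) : SatisfiesBalancedEquations η m w z W Z where
  force_z := h.force_w
  force_w := h.force_z
  diag_Z := h.diag_W
  diag_W := h.diag_Z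
  antisymm_Z := h.antisymm_W
  antisymm_W := h.antisymm_Z
  cross i j := (h.cross i j).symm
  normalized i j hij := by rw [← h.cross i j, mul_comm (w j - w i)]; exact h.normalized i j hij

/-- The complex conjugate coordinates are exchanged. -/
def ComplexPoint.swap (Q : ComplexPoint) : ComplexPoint := ⟨Q.w, Q.W, Q.z, Q.Z⟩

/-- `1 / r_ij`, in the form `Z_ij w_ij`. -/
def ComplexPoint.invDist (Q : ComplexPoint) (i j : Fin 4) : ℂ := Q.Z i j * (Q.w j - Q.w i)

section

variable {η : ℝ} {m : Fin 4 → ℝ} {Q : ComplexPoint}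

theorem SatisfiesBalancedEquations.invDist_swap
    (h : SatisfiesBalancedEquations η m Q.z Q.w Q.Z Q.W) (i j : Fin 4) :
    Q.swap.invDist i j = Q.invDist i j := (h.cross i j).symm

theorem SatisfiesBalancedEquations.invDist_symm
    (h : SatisfiesBalancedEquations η m Q.z Q.w Q.Z Q.W) (i j : Fin 4) :
    Q.invDist i j = Q.invDist j i := by
  rw [ComplexPoint.invDist, ComplexPoint.invDist, h.antisymm_Z i j]; ring

theorem SatisfiesBalancedEquations.invDist_sq
    (h : SatisfiesBalancedEquations η m Q.z Q.w Q.Z Q.W) {i j : Fin 4} (hij : i ≠ j) :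
    Q.invDist i j ^ 2 * ((Q.z j - Q.z i) * (Q.w j - Q.w i)) = 1 := h.normalized i j hij

theorem SatisfiesBalancedEquations.invDist_ne_zero
    (h : SatisfiesBalancedEquations η m Q.z Q.w Q.Z Q.W) {i j : Fin 4} (hij : i ≠ j) :
    Q.invDist i j ≠ 0 := fun h0 => by simpa [h0] using h.invDist_sq hij

theorem SatisfiesBalancedEquations.Z_ne_zero
    (h : SatisfiesBalancedEquations η m Q.z Q.w Q.Z Q.W) {i j : Fin 4} (hij : i ≠ j) :
    Q.Z i j ≠ 0 := left_ne_zero_of_mul (h.invDist_ne_zero hij)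

theorem SatisfiesBalancedEquations.invDist_cube_mul
    (h : SatisfiesBalancedEquations η m Q.z Q.w Q.Z Q.W) (i j : Fin 4) :
    Q.invDist i j ^ 3 * (Q.z j - Q.z i) = Q.Z i j := by
  by_cases hij : i = j
  · subst hij; simp [h.diag_Z]
  have := h.invDist_sq hij
  have e : Q.invDist i j = Q.Z i j * (Q.w j - Q.w i) := rfl
  linear_combination Q.invDist i j ^ 2 * (Q.z j - Q.z i) * e + Q.Z i j * this

theorem SatisfiesBalancedEquations.invDist_pow_four
    (h : SatisfiesBalancedEquations η m Q.z Q.w Q.Z Q.W) (i j : Fin 4) :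
    Q.invDist i j ^ 4 = Q.Z i j * Q.W i j := by
  have e1 := h.invDist_cube_mul i j
  have e2 := h.cross i j
  have e : Q.invDist i j = Q.Z i j * (Q.w j - Q.w i) := rfl
  linear_combination Q.invDist i j ^ 3 * (e + e2) + Q.W i j * e1

theorem SatisfiesBalancedEquations.two_mul_momentOfInertia
    (h : SatisfiesBalancedEquations η m Q.z Q.w Q.Z Q.W) :
    2 * Q.momentOfInertia η m = ∑ j, ∑ k, (m j : ℂ) * m k * Q.invDist k j := by
  rw [Q.two_mul_momentOfInertia]
  exact h.inertia_eq_potential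

end

open scoped Topology

/-- A sequence of points of the variety, all of whose coordinates are of order at most `s ^ (-2)`,
with the limits of the rescaled quantities: `ζ`, `ω` of the positions, `α`, `β` of the `Z_ij` and the
`W_ij` (a stroke of the first or second colour is a pair where `α` or `β` is not zero), and `ρ` of
`s / r_ij`. -/
structure SingularLimit (η : ℝ) (m : Fin 4 → ℝ) (l : Filter ℕ) (s : ℕ → ℂ) (Q : ℕ → ComplexPoint)
    (ζ ω : Fin 4 → ℂ) (α β ρ : Fin 4 → Fin 4 → ℂ) : Prop where
  s_ne_zero : ∀ n, s n ≠ 0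
  tendsto_s : Tendsto s l (𝓝 0)
  equations : ∀ n, SatisfiesBalancedEquations η m (Q n).z (Q n).w (Q n).Z (Q n).W
  tendsto_z : ∀ j, Tendsto (fun n => s n ^ 2 * (Q n).z j) l (𝓝 (ζ j))
  tendsto_w : ∀ j, Tendsto (fun n => s n ^ 2 * (Q n).w j) l (𝓝 (ω j))
  tendsto_Z : ∀ i j, Tendsto (fun n => s n ^ 2 * (Q n).Z i j) l (𝓝 (α i j))
  tendsto_W : ∀ i j, Tendsto (fun n => s n ^ 2 * (Q n).W i j) l (𝓝 (β i j))
  tendsto_invDist : ∀ i j, Tendsto (fun n => s n * (Q n).invDist i j) l (𝓝 (ρ i j))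

/-- A singular sequence of equal order has a rescaled limit along an ultrafilter, in which neither
half of the coordinates vanishes. -/
theorem exists_singularLimit {η : ℝ} (hη₀ : 0 < η) (hη₁ : η < 1) {m : Fin 4 → ℝ}
    {Q : ℕ → ComplexPoint} (hQ : ∀ n, Q n ∈ balancedVariety η m)
    (hN : Tendsto (fun n => max (Q n).normZ (Q n).normW) atTop atTop) (hE : IsOfEqualOrder Q) :
    ∃ (l : Filter ℕ) (s : ℕ → ℂ) (ζ ω : Fin 4 → ℂ) (α β ρ : Fin 4 → Fin 4 → ℂ),
      l.NeBot ∧ SingularLimit η m l s Q ζ ω α β ρ ∧ ¬ (ζ = 0 ∧ α = 0) ∧ ¬ (ω = 0 ∧ β = 0) := by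
  have heq := fun n => satisfiesBalancedEquations_of_mem hη₀ hη₁ (hQ n)
  let N : ℕ → ℝ := fun n => max (Q n).normZ (Q n).normW
  have hcoord : ∀ n i, ‖(Q n).coord i‖ ≤ N n := fun n => (Q n).norm_coord_le
  have hNpos : ∀ n, 0 < N n := fun n =>
    (norm_pos_iff.mpr ((heq n).Z_ne_zero (i := 0) (j := 1) (by decide))).trans_le
      (hcoord n (.inl (.inr (0, 1))))
  let s : ℕ → ℂ := fun n => (((√(N n))⁻¹ : ℝ) : ℂ)
  have hs2 : ∀ n, ‖s n‖ ^ 2 = (N n)⁻¹ := fun n => by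
    simp only [s, Complex.norm_real, norm_inv, inv_pow, Real.norm_eq_abs, sq_abs,
      Real.sq_sqrt (hNpos n).le]
  have hle : (hyperfilter ℕ : Filter ℕ) ≤ atTop := Nat.hyperfilter_le_atTop
  have hlim : ∀ f : ℕ → ℂ, (∀ n, ‖f n‖ ≤ 1) →
      ∃ a, Tendsto f (hyperfilter ℕ : Filter ℕ) (𝓝 a) := by
    intro f hf
    obtain ⟨a, -, ha⟩ := (isCompact_closedBall (0 : ℂ) 1).ultrafilter_le_nhds
      ((hyperfilter ℕ).map f) (by
        rw [le_principal_iff, Ultrafilter.coe_map]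
        exact Filter.mem_map.mpr (univ_mem' fun n => mem_closedBall_zero_iff.mpr (hf n)))
    exact ⟨a, ha⟩
  have hscaled : ∀ n i, ‖s n ^ 2 * (Q n).coord i‖ ≤ 1 := fun n i => by
    rw [norm_mul, norm_pow, hs2, inv_mul_le_one₀ (hNpos n)]; exact hcoord n i
  choose ζ hζ using fun j => hlim (fun n => s n ^ 2 * (Q n).z j) fun n => hscaled n (.inl (.inl j))
  choose ω hω using fun j => hlim (fun n => s n ^ 2 * (Q n).w j) fun n => hscaled n (.inr (.inl j))
  choose α hα using fun i j => hlim (fun n => s n ^ 2 * (Q n).Z i j)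
    fun n => hscaled n (.inl (.inr (i, j)))
  choose β hβ using fun i j => hlim (fun n => s n ^ 2 * (Q n).W i j)
    fun n => hscaled n (.inr (.inr (i, j)))
  choose ρ hρ using fun i j => hlim (fun n => s n * (Q n).invDist i j) fun n => by
    refine (pow_le_one_iff_of_nonneg (norm_nonneg _) four_ne_zero).mp ?_
    rw [← norm_pow, show (s n * (Q n).invDist i j) ^ 4 =
      (s n ^ 2 * (Q n).Z i j) * (s n ^ 2 * (Q n).W i j) by
        rw [mul_pow, (heq n).invDist_pow_four]; ring, norm_mul]
    exact mul_le_one₀ (hscaled n (.inl (.inr (i, j)))) (norm_nonneg _)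
      (hscaled n (.inr (.inr (i, j))))
  have hs0 : Tendsto s (hyperfilter ℕ : Filter ℕ) (𝓝 0) := by
    have h1 : Tendsto (fun n => (√(N n))⁻¹) atTop (𝓝 0) :=
      tendsto_inv_atTop_zero.comp (Real.tendsto_sqrt_atTop.comp hN)
    have h2 := (Complex.continuous_ofReal.tendsto 0).comp (h1.mono_left hle)
    simpa [s, Function.comp_def] using h2
  have hone : ∀ n, ‖s n‖ ^ 2 * N n = 1 := fun n => by
    rw [hs2]; exact inv_mul_cancel₀ (hNpos n).ne'
  -- If one of the rescaled norms tended to zero, so would the other one, but their maximum is `1`.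
  have hcontra : ∀ f g : ℕ → ℝ, f =O[atTop] g → (∀ n, N n = max (f n) (g n)) → (∀ n, 0 ≤ g n) →
      ¬ Tendsto (fun n => ‖s n‖ ^ 2 * g n) (hyperfilter ℕ : Filter ℕ) (𝓝 0) := by
    intro f g hfg hmax hg h0
    obtain ⟨c, hc⟩ := hfg.bound
    have h1 : ∀ᶠ n in (hyperfilter ℕ : Filter ℕ), 1 ≤ (max c 1) * (‖s n‖ ^ 2 * g n) := by
      filter_upwards [hle hc] with n hn
      rw [mul_left_comm]
      refine (hone n).symm.trans_le (mul_le_mul_of_nonneg_left ?_ (by positivity))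
      rw [hmax n]
      refine max_le ?_ (le_mul_of_one_le_left (hg n) (le_max_right _ _))
      refine (le_abs_self _).trans (hn.trans ?_)
      rw [Real.norm_of_nonneg (hg n)]
      exact mul_le_mul_of_nonneg_right (le_max_left _ _) (hg n)
    have h2 := h0.const_mul (max c 1)
    rw [mul_zero] at h2
    exact absurd (ge_of_tendsto h2 h1) (by norm_num)
  have hnorm : ∀ (x : ℕ → Fin 4 → ℂ) (y : ℕ → Fin 4 → Fin 4 → ℂ),
      (∀ j, Tendsto (fun n => s n ^ 2 * x n j) (hyperfilter ℕ : Filter ℕ) (𝓝 0)) →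
      (∀ i j, Tendsto (fun n => s n ^ 2 * y n i j) (hyperfilter ℕ : Filter ℕ) (𝓝 0)) →
      Tendsto (fun n => ‖s n‖ ^ 2 * ‖(x n, y n)‖) (hyperfilter ℕ : Filter ℕ) (𝓝 0) := by
    intro x y hx hy
    have h1 : Tendsto (fun n => s n ^ 2 • x n) (hyperfilter ℕ : Filter ℕ) (𝓝 0) :=
      tendsto_pi_nhds.mpr hx
    have h2 : Tendsto (fun n => s n ^ 2 • y n) (hyperfilter ℕ : Filter ℕ) (𝓝 0) :=
      tendsto_pi_nhds.mpr fun i => tendsto_pi_nhds.mpr (hy i)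
    have h3 := (h1.prodMk_nhds h2).norm
    simpa only [← Prod.smul_mk, norm_smul, norm_pow, Prod.mk_zero_zero, norm_zero] using h3
  refine ⟨_, s, ζ, ω, α, β, ρ, inferInstance, ⟨fun n => ?_, hs0, heq, hζ, hω, hα, hβ, hρ⟩, ?_, ?_⟩
  · have := hone n
    intro h0
    simp [h0] at this
  · rintro ⟨rfl, rfl⟩
    exact hcontra _ _ hE.2 (fun n => max_comm _ _) (fun n => norm_nonneg _) (hnorm _ _ hζ hα)
  · rintro ⟨rfl, rfl⟩
    exact hcontra _ _ hE.1 (fun n => rfl) (fun n => norm_nonneg _) (hnorm _ _ hω hβ)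

namespace SingularLimit

variable {η : ℝ} {m : Fin 4 → ℝ} {l : Filter ℕ} {s : ℕ → ℂ} {Q : ℕ → ComplexPoint}
  {ζ ω : Fin 4 → ℂ} {α β ρ : Fin 4 → Fin 4 → ℂ}

theorem swap (h : SingularLimit η m l s Q ζ ω α β ρ) :
    SingularLimit η m l s (fun n => (Q n).swap) ω ζ β α ρ where
  s_ne_zero := h.s_ne_zero
  tendsto_s := h.tendsto_s
  equations n := (h.equations n).swap
  tendsto_z := h.tendsto_w
  tendsto_w := h.tendsto_z
  tendsto_Z := h.tendsto_W
  tendsto_W := h.tendsto_Z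
  tendsto_invDist i j := by
    simpa only [(h.equations _).invDist_swap] using h.tendsto_invDist i j

/-- The first halves of the points `i` and `j` are close: `z_ij / s` has a limit. -/
def CloseZ (l : Filter ℕ) (s : ℕ → ℂ) (Q : ℕ → ComplexPoint) (i j : Fin 4) : Prop :=
  ∃ a, Tendsto (fun n => ((Q n).z j - (Q n).z i) / s n) l (𝓝 a)

/-- The second halves of the points `i` and `j` are close: `w_ij / s` has a limit. -/
abbrev CloseW (l : Filter ℕ) (s : ℕ → ℂ) (Q : ℕ → ComplexPoint) (i j : Fin 4) : Prop :=
  CloseZ l s (fun n => (Q n).swap) i j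

theorem CloseZ.symm {i j : Fin 4} (h : CloseZ l s Q i j) : CloseZ l s Q j i := by
  obtain ⟨a, ha⟩ := h
  exact ⟨-a, ha.neg.congr fun n => by ring⟩

theorem CloseZ.trans {i j k : Fin 4} (h : CloseZ l s Q i j) (h' : CloseZ l s Q j k) :
    CloseZ l s Q i k := by
  obtain ⟨a, ha⟩ := h
  obtain ⟨b, hb⟩ := h'
  exact ⟨a + b, (ha.add hb).congr fun n => by ring⟩

variable [l.NeBot]

theorem force_z (h : SingularLimit η m l s Q ζ ω α β ρ) (j : Fin 4) :
    ζ j + η * ω j = ∑ k, (m k : ℂ) * α k j := by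
  refine tendsto_nhds_unique ((h.tendsto_z j).add ((h.tendsto_w j).const_mul (η : ℂ))) ?_
  refine (tendsto_finsetSum Finset.univ fun k _ =>
    (h.tendsto_Z k j).const_mul (m k : ℂ)).congr fun n => ?_
  have := (h.equations n).force_z j
  simp only [Algebra.algebraMap_self, RingHom.id_apply] at this
  rw [show s n ^ 2 * (Q n).z j + η * (s n ^ 2 * (Q n).w j) =
    s n ^ 2 * ((Q n).z j + η * (Q n).w j) by ring, this, Finset.mul_sum]
  exact Finset.sum_congr rfl fun k _ => by ring

theorem antisymm (h : SingularLimit η m l s Q ζ ω α β ρ) (i j : Fin 4) : α i j = -α j i :=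
  tendsto_nhds_unique (h.tendsto_Z i j) ((h.tendsto_Z j i).neg.congr fun n => by
    rw [(h.equations n).antisymm_Z i j]; ring)

theorem diag (h : SingularLimit η m l s Q ζ ω α β ρ) (i : Fin 4) : α i i = 0 :=
  self_eq_neg.mp (h.antisymm i i)

theorem stroke_symm (h : SingularLimit η m l s Q ζ ω α β ρ) {i j : Fin 4} (hij : α i j ≠ 0) :
    α j i ≠ 0 := by rw [h.antisymm]; exact neg_ne_zero.mpr hij

theorem rho_symm (h : SingularLimit η m l s Q ζ ω α β ρ) (i j : Fin 4) : ρ i j = ρ j i :=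
  tendsto_nhds_unique (h.tendsto_invDist i j) ((h.tendsto_invDist j i).congr fun n => by
    rw [(h.equations n).invDist_symm])

/-- Bodies joined by a stroke of one colour have the same limit position of the other one. -/
theorem eq_of_stroke (h : SingularLimit η m l s Q ζ ω α β ρ) {i j : Fin 4} (hij : α i j ≠ 0) :
    ω i = ω j := by
  have h1 : α i j * (ω j - ω i) = 0 := by
    refine tendsto_nhds_unique
      ((h.tendsto_Z i j).mul ((h.tendsto_w j).sub (h.tendsto_w i))) ?_
    have h2 := (h.tendsto_s.pow 3).mul (h.tendsto_invDist i j)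
    rw [zero_pow three_ne_zero, zero_mul] at h2
    exact h2.congr fun n => by simp only [ComplexPoint.invDist]; ring
  exact (sub_eq_zero.mp ((mul_eq_zero.mp h1).resolve_left hij)).symm

theorem rho_pow_four (h : SingularLimit η m l s Q ζ ω α β ρ) (i j : Fin 4) :
    ρ i j ^ 4 = α i j * β i j :=
  tendsto_nhds_unique ((h.tendsto_invDist i j).pow 4)
    (((h.tendsto_Z i j).mul (h.tendsto_W i j)).congr fun n => by
      rw [mul_pow, (h.equations n).invDist_pow_four]; ring)

theorem rho_ne_zero_iff (h : SingularLimit η m l s Q ζ ω α β ρ) {i j : Fin 4} :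
    ρ i j ≠ 0 ↔ α i j ≠ 0 ∧ β i j ≠ 0 := by
  rw [← mul_ne_zero_iff, ← h.rho_pow_four, Ne, Ne, pow_eq_zero_iff four_ne_zero]

theorem ne_of_stroke (h : SingularLimit η m l s Q ζ ω α β ρ) {i j : Fin 4} (hij : α i j ≠ 0) :
    i ≠ j := by
  rintro rfl
  exact hij (h.diag i)

/-- Along a stroke of the first colour `w_ij = 1 / (r_ij Z_ij)`. -/
theorem tendsto_of_stroke (h : SingularLimit η m l s Q ζ ω α β ρ) {i j : Fin 4}
    (hij : α i j ≠ 0) :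
    Tendsto (fun n => ((Q n).w j - (Q n).w i) / s n) l (𝓝 (ρ i j / α i j)) :=
  ((h.tendsto_invDist i j).div (h.tendsto_Z i j) hij).congr fun n => by
    have h1 := h.s_ne_zero n
    have h2 := (h.equations n).Z_ne_zero (h.ne_of_stroke hij)
    simp only [Pi.div_apply, ComplexPoint.invDist]
    field_simp

theorem closeW_of_stroke (h : SingularLimit η m l s Q ζ ω α β ρ) {i j : Fin 4}
    (hij : α i j ≠ 0) : CloseW l s Q i j := ⟨_, h.tendsto_of_stroke hij⟩

theorem closeZ_of_stroke (h : SingularLimit η m l s Q ζ ω α β ρ) {i j : Fin 4}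
    (hij : β i j ≠ 0) : CloseZ l s Q i j := ⟨_, h.swap.tendsto_of_stroke hij⟩

theorem mul_rho_cube (h : SingularLimit η m l s Q ζ ω α β ρ) {i j : Fin 4} {a : ℂ}
    (ha : Tendsto (fun n => ((Q n).z j - (Q n).z i) / s n) l (𝓝 a)) : a * ρ i j ^ 3 = α i j :=
  tendsto_nhds_unique (ha.mul ((h.tendsto_invDist i j).pow 3))
    ((h.tendsto_Z i j).congr fun n => by
      have h1 := h.s_ne_zero n
      rw [← (h.equations n).invDist_cube_mul]
      field_simp)

theorem rho_ne_zero_of_closeZ (h : SingularLimit η m l s Q ζ ω α β ρ) {i j : Fin 4}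
    (hc : CloseZ l s Q i j) (hij : α i j ≠ 0) : ρ i j ≠ 0 := by
  obtain ⟨a, ha⟩ := hc
  intro h0
  apply hij
  rw [← h.mul_rho_cube ha, h0]; ring

theorem rho_ne_zero_of_close (h : SingularLimit η m l s Q ζ ω α β ρ) {i j : Fin 4} (hne : i ≠ j)
    (hz : CloseZ l s Q i j) (hw : CloseW l s Q i j) : ρ i j ≠ 0 := by
  obtain ⟨a, ha⟩ := hz
  obtain ⟨b, hb⟩ := hw
  have h1 : ρ i j ^ 2 * (a * b) = 1 :=
    tendsto_nhds_unique (((h.tendsto_invDist i j).pow 2).mul (ha.mul hb))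
      (tendsto_const_nhds.congr fun n => by
        have h1 := h.s_ne_zero n
        rw [← (h.equations n).invDist_sq hne]
        simp only [ComplexPoint.swap]
        field_simp)
  intro h0
  simp [h0] at h1

/-- Pairs of both colours are the edges of an equivalence relation. -/
theorem rho_trans (h : SingularLimit η m l s Q ζ ω α β ρ) {i j k : Fin 4} (hik : i ≠ k)
    (h1 : ρ i j ≠ 0) (h2 : ρ j k ≠ 0) : ρ i k ≠ 0 := by
  rw [h.rho_ne_zero_iff] at h1 h2
  exact h.rho_ne_zero_of_close hik
    ((h.closeZ_of_stroke h1.2).trans (h.closeZ_of_stroke h2.2))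
    ((h.closeW_of_stroke h1.1).trans (h.closeW_of_stroke h2.1))

/-- A stroke of the first colour between two bodies joined by a path of two strokes of the second
colour carries both colours. -/
theorem both_of_path (h : SingularLimit η m l s Q ζ ω α β ρ) {i j k : Fin 4} (h1 : β i j ≠ 0)
    (h2 : β j k ≠ 0) (h3 : α i k ≠ 0) : β i k ≠ 0 :=
  (h.rho_ne_zero_iff.mp (h.rho_ne_zero_of_closeZ
    ((h.closeZ_of_stroke h1).trans (h.closeZ_of_stroke h2)) h3)).2

/-- If a triangle of strokes of the first colour has an edge of both colours, so are its other
edges. -/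
theorem triangle (h : SingularLimit η m l s Q ζ ω α β ρ) {i j k : Fin 4} (h1 : α i j ≠ 0)
    (h2 : α j k ≠ 0) (h3 : α i k ≠ 0) (hb : β i j ≠ 0) : β j k ≠ 0 ∧ β i k ≠ 0 := by
  have hij := h.rho_ne_zero_iff.mpr ⟨h1, hb⟩
  have e : ρ i j / α i j + ρ j k / α j k = ρ i k / α i k :=
    tendsto_nhds_unique ((h.tendsto_of_stroke h1).add (h.tendsto_of_stroke h2))
      ((h.tendsto_of_stroke h3).congr fun n => by ring)
  have hji : ρ j i ≠ 0 := by rwa [h.rho_symm]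
  by_cases hjk : ρ j k = 0
  · have hik : ρ i k ≠ 0 := by
      intro h0
      rw [hjk, h0, zero_div, zero_div, add_zero, div_eq_zero_iff] at e
      exact e.elim hij h1
    exact absurd hjk (h.rho_trans (h.ne_of_stroke h2) hji hik)
  · exact ⟨(h.rho_ne_zero_iff.mp hjk).2,
      (h.rho_ne_zero_iff.mp (h.rho_trans (h.ne_of_stroke h3) hij hjk)).2⟩

/-- The strokes inside a union of classes cancel by antisymmetry. -/
theorem classRelations_sum (h : SingularLimit η m l s Q ζ ω α β ρ) (R : Fin 4 → Prop)
    [DecidablePred R] (hR : ∀ i j, α i j ≠ 0 → (R i ↔ R j)) :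
    ∑ j, (if R j then (m j : ℂ) * (ζ j + η * ω j) else 0) = 0 := by
  have h1 : ∑ j, (if R j then (m j : ℂ) * (ζ j + η * ω j) else 0) =
      ∑ j, ∑ k, (if R j then (m j : ℂ) * m k * α k j else 0) := by
    refine Finset.sum_congr rfl fun j _ => ?_
    split_ifs
    · rw [h.force_z, Finset.mul_sum]; exact Finset.sum_congr rfl fun k _ => by ring
    · simp
  rw [h1]
  refine self_eq_neg.mp ?_
  conv_lhs => rw [Finset.sum_comm]
  rw [← Finset.sum_neg_distrib]
  refine Finset.sum_congr rfl fun j _ => ?_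
  rw [← Finset.sum_neg_distrib]
  refine Finset.sum_congr rfl fun k _ => ?_
  by_cases h0 : α j k = 0
  · rw [h.antisymm k j, h0]; simp
  · simp only [hR j k h0]
    split_ifs
    · rw [h.antisymm k j]; ring
    · simp

theorem classRelations (h : SingularLimit η m l s Q ζ ω α β ρ) :
    ClassRelations η m ζ ω (Relation.ReflTransGen fun i j => α i j ≠ 0)
      (Relation.ReflTransGen fun i j => β i j ≠ 0) where
  equiv_z := ⟨fun _ => .refl, fun hr =>
    have : Std.Symm (fun i j => α i j ≠ 0) := ⟨fun _ _ => h.stroke_symm⟩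
    Relation.ReflTransGen.stdSymm.symm _ _ hr, fun h1 h2 => h1.trans h2⟩
  equiv_w := ⟨fun _ => .refl, fun hr =>
    have : Std.Symm (fun i j => β i j ≠ 0) := ⟨fun _ _ => h.swap.stroke_symm⟩
    Relation.ReflTransGen.stdSymm.symm _ _ hr, fun h1 h2 => h1.trans h2⟩
  const_w i j hr := by
    induction hr with
    | refl => rfl
    | tail _ h1 h2 => rw [h2, h.eq_of_stroke h1]
  const_z i j hr := by
    induction hr with
    | refl => rfl
    | tail _ h1 h2 => rw [h2, h.swap.eq_of_stroke h1]
  sum_z i := by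
    classical
    convert h.classRelations_sum (fun j => Relation.ReflTransGen (fun i j => α i j ≠ 0) i j)
      fun j k hjk => ⟨fun h1 => h1.tail hjk, fun h1 => h1.tail (h.stroke_symm hjk)⟩
  sum_w i := by
    classical
    convert h.swap.classRelations_sum (fun j => Relation.ReflTransGen (fun i j => β i j ≠ 0) i j)
      fun j k hjk => ⟨fun h1 => h1.tail hjk, fun h1 => h1.tail (h.swap.stroke_symm hjk)⟩

end SingularLimit

/-- A relation between three fourth roots of the same number with positive coefficients. -/
theorem eq_add_of_fourth_roots {p₁ p₂ p₃ : ℝ} (h₁ : 0 < p₁) (h₂ : 0 < p₂) (h₃ : 0 < p₃)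
    {t₁ t₂ t₃ : ℂ} (ht : t₁ ≠ 0) (h12 : t₂ ^ 4 = t₁ ^ 4) (h13 : t₃ ^ 4 = t₁ ^ 4)
    (hsum : (p₁ : ℂ) * t₁ + p₂ * t₂ + p₃ * t₃ = 0) :
    p₁ = p₂ + p₃ ∨ p₂ = p₁ + p₃ ∨ p₃ = p₁ + p₂ := by
  have key : ∀ t : ℂ, t ^ 4 = t₁ ^ 4 →
      t = t₁ ∨ t = -t₁ ∨ t = Complex.I * t₁ ∨ t = -(Complex.I * t₁) := by
    intro t h
    have : (t - t₁) * ((t + t₁) * ((t - Complex.I * t₁) * (t + Complex.I * t₁))) = 0 := by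
      linear_combination h - (t ^ 2 - t₁ ^ 2) * t₁ ^ 2 * Complex.I_sq
    simpa only [mul_eq_zero, sub_eq_zero, add_eq_zero_iff_eq_neg] using this
  have red : ∀ a b : ℝ, ((a : ℂ) + b * Complex.I) * t₁ = 0 → a = 0 ∧ b = 0 := by
    intro a b hab
    have h0 := (mul_eq_zero.mp hab).resolve_right ht
    have hr := congrArg Complex.re h0
    have hi := congrArg Complex.im h0
    simp at hr hi
    exact ⟨hr, hi⟩
  have fin : ∀ a b : ℝ, ((a : ℂ) + b * Complex.I) * t₁ = (p₁ : ℂ) * t₁ + p₂ * t₂ + p₃ * t₃ →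
      a = 0 ∧ b = 0 := fun a b hab => red a b (hab.trans hsum)
  rcases key t₂ h12 with rfl | rfl | rfl | rfl <;> rcases key t₃ h13 with rfl | rfl | rfl | rfl
  · have := fin (p₁ + p₂ + p₃) 0 (by push_cast; ring); linarith [this.1]
  · have := fin (p₁ + p₂ - p₃) 0 (by push_cast; ring); right; right; linarith [this.1]
  · have := fin (p₁ + p₂) p₃ (by push_cast; ring); linarith [this.1]
  · have := fin (p₁ + p₂) (-p₃) (by push_cast; ring); linarith [this.1]
  · have := fin (p₁ - p₂ + p₃) 0 (by push_cast; ring); right; left; linarith [this.1]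
  · have := fin (p₁ - p₂ - p₃) 0 (by push_cast; ring); left; linarith [this.1]
  · have := fin (p₁ - p₂) p₃ (by push_cast; ring); linarith [this.2]
  · have := fin (p₁ - p₂) (-p₃) (by push_cast; ring); linarith [this.2]
  · have := fin (p₁ + p₃) p₂ (by push_cast; ring); linarith [this.2]
  · have := fin (p₁ - p₃) p₂ (by push_cast; ring); linarith [this.2]
  · have := fin p₁ (p₂ + p₃) (by push_cast; ring); linarith [this.1]
  · have := fin p₁ (p₂ - p₃) (by push_cast; ring); linarith [this.1]
  · have := fin (p₁ + p₃) (-p₂) (by push_cast; ring); linarith [this.2]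
  · have := fin (p₁ - p₃) (-p₂) (by push_cast; ring); linarith [this.2]
  · have := fin p₁ (-p₂ + p₃) (by push_cast; ring); linarith [this.1]
  · have := fin p₁ (-p₂ - p₃) (by push_cast; ring); linarith [this.1]

theorem eq_of_distinct {i j k l : Fin 4} (hij : i ≠ j) (hik : i ≠ k) (hil : i ≠ l) (hjk : j ≠ k)
    (hjl : j ≠ l) (hkl : k ≠ l) (x : Fin 4) : x = i ∨ x = j ∨ x = k ∨ x = l := by
  decide +revert

theorem Asymptotics.IsBigO.mul_tendsto_zero {l : Filter ℕ} {f g : ℕ → ℂ}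
    (hf : f =O[l] (fun _ => (1 : ℝ))) (hg : Tendsto g l (𝓝 0)) :
    Tendsto (fun n => f n * g n) l (𝓝 0) := by
  have := hf.mul_isLittleO ((isLittleO_one_iff ℝ).mpr hg)
  simp only [mul_one] at this
  exact (isLittleO_one_iff ℝ).mp this

namespace SingularLimit

variable {η : ℝ} {m : Fin 4 → ℝ} {l : Filter ℕ} {s : ℕ → ℂ} {Q : ℕ → ComplexPoint}
  {ζ ω : Fin 4 → ℂ} {α β ρ : Fin 4 → Fin 4 → ℂ}

/-! ### Limits with separated positions -/

theorem isBigO_invDist_of_ne (h : SingularLimit η m l s Q ζ ω α β ρ) {i j : Fin 4}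
    (hne : ζ i ≠ ζ j) : (fun n => (Q n).invDist i j) =O[l] (fun _ => (1 : ℝ)) := by
  have h0 : ζ j - ζ i ≠ 0 := sub_ne_zero.mpr hne.symm
  have h1 : Tendsto (fun n => s n ^ 2 * (Q n).Z i j / (s n ^ 2 * (Q n).z j - s n ^ 2 * (Q n).z i)) l
      (𝓝 (α i j / (ζ j - ζ i))) :=
    (h.tendsto_Z i j).div ((h.tendsto_z j).sub (h.tendsto_z i)) h0
  have h2 : (fun n => (Q n).invDist i j ^ 3) =O[l] (fun _ => (1 : ℝ)) := by
    refine (h1.isBigO_one ℝ).congr_left fun n => ?_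
    have hs := h.s_ne_zero n
    have hij : i ≠ j := fun e => hne (by rw [e])
    have hz : (Q n).z j - (Q n).z i ≠ 0 := fun h3 => by
      have := (h.equations n).invDist_sq hij
      simp [h3] at this
    rw [← mul_sub, ← (h.equations n).invDist_cube_mul]
    field_simp
  obtain ⟨C, hC⟩ := h2.bound
  refine IsBigO.of_bound (1 + C) ?_
  filter_upwards [hC] with n hn
  rw [norm_pow, norm_one, mul_one] at hn
  rw [norm_one, mul_one]
  have hp := norm_nonneg ((Q n).invDist i j)
  nlinarith [mul_nonneg hp (sq_nonneg (‖(Q n).invDist i j‖ - 1)), sq_nonneg (‖(Q n).invDist i j‖ - 1)]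

variable [l.NeBot]

theorem tendsto_zero_of_stroke (h : SingularLimit η m l s Q ζ ω α β ρ) {i j : Fin 4}
    (hij : α i j ≠ 0) : Tendsto (fun n => (Q n).w j - (Q n).w i) l (𝓝 0) := by
  have := h.tendsto_s.mul (h.tendsto_of_stroke hij)
  rw [zero_mul] at this
  exact this.congr fun n => mul_div_cancel₀ _ (h.s_ne_zero n)

theorem exists_stroke_of_related (i j : Fin 4) (hij : i ≠ j)
    (hr : Relation.ReflTransGen (fun i j => α i j ≠ 0) i j) : ∃ k, α i k ≠ 0 := by
  rcases hr.cases_head with e | ⟨k, hk, -⟩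
  · exact absurd e hij
  · exact ⟨k, hk⟩

/-- If `j` and `n` are not joined by a stroke of the first colour, but both belong to a class of
three bodies of this colour, then they are joined through the third body `i`. -/
theorem tendsto_zero_of_triple (h : SingularLimit η m l s Q ζ ω α β ρ) {i j k n : Fin 4}
    (hij : i ≠ j) (hik : i ≠ k) (hin : i ≠ n) (hjk : j ≠ k) (hjn : j ≠ n) (hkn : k ≠ n)
    (h1 : Relation.ReflTransGen (fun i j => α i j ≠ 0) i j)
    (h2 : Relation.ReflTransGen (fun i j => α i j ≠ 0) i n)
    (hω : ω j ≠ ω k) (h0 : α j n = 0) :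
    Tendsto (fun t => (Q t).w n - (Q t).w j) l (𝓝 0) := by
  have hc := h.classRelations
  have ej := hc.const_w _ _ h1
  have en := hc.const_w _ _ h2
  have hi1 : α j i ≠ 0 := by
    obtain ⟨x, hx⟩ := exists_stroke_of_related j i hij.symm (hc.equiv_z.symm h1)
    rcases eq_of_distinct hij hik hin hjk hjn hkn x with rfl | rfl | rfl | rfl
    · exact hx
    · exact absurd (h.diag _) hx
    · exact absurd (h.eq_of_stroke hx) hω
    · exact absurd h0 hx
  have hi2 : α i n ≠ 0 := by
    apply h.stroke_symm
    obtain ⟨x, hx⟩ := exists_stroke_of_related n i hin.symm (hc.equiv_z.symm h2)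
    rcases eq_of_distinct hij hik hin hjk hjn hkn x with rfl | rfl | rfl | rfl
    · exact hx
    · exact absurd h0 (h.stroke_symm hx)
    · exact absurd ((ej.symm.trans en).trans (h.eq_of_stroke hx)) hω
    · exact absurd (h.diag _) hx
  have := (h.tendsto_zero_of_stroke hi1).add (h.tendsto_zero_of_stroke hi2)
  rw [add_zero] at this
  exact this.congr fun t => by ring

theorem stroke_eq_zero_of_tendsto (h : SingularLimit η m l s Q ζ ω α β ρ) {i j : Fin 4}
    (hb : (fun n => (Q n).invDist i j) =O[l] (fun _ => (1 : ℝ)))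
    (hz : Tendsto (fun n => (Q n).z j - (Q n).z i) l (𝓝 0)) : α i j = 0 := by
  have h1 : (fun n => (Q n).invDist i j ^ 3) =O[l] (fun _ => (1 : ℝ)) := by
    simpa using hb.pow 3
  have h2 := (h.tendsto_s.pow 2).mul (h1.mul_tendsto_zero hz)
  rw [mul_zero] at h2
  exact tendsto_nhds_unique (h.tendsto_Z i j)
    (h2.congr fun n => by rw [(h.equations n).invDist_cube_mul])

/-- Two classes `{i, j, n}` and `{j, k, n}` of different colours are impossible when the moment of
inertia, hence the potential, is bounded: all distances but `r_jn` are bounded below, so `r_jn` is,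
whereas the strokes force `j` and `n` to collide. -/
theorem not_overlapping_triples (h : SingularLimit η m l s Q ζ ω α β ρ) (hm : ∀ j, 0 < m j)
    (hI : (fun n => (Q n).momentOfInertia η m) =O[l] (fun _ => (1 : ℝ))) {i j k n : Fin 4}
    (hij : i ≠ j) (hik : i ≠ k) (hin : i ≠ n) (hjk : j ≠ k) (hjn : j ≠ n) (hkn : k ≠ n)
    (h1 : Relation.ReflTransGen (fun i j => α i j ≠ 0) i j)
    (h2 : Relation.ReflTransGen (fun i j => α i j ≠ 0) i n)
    (h3 : Relation.ReflTransGen (fun i j => β i j ≠ 0) k j)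
    (h4 : Relation.ReflTransGen (fun i j => β i j ≠ 0) k n)
    (hζ : ζ i ≠ ζ j) (hω : ω j ≠ ω k) : False := by
  have hc := h.classRelations
  have eij := hc.const_w _ _ h1
  have ein := hc.const_w _ _ h2
  have ekj := hc.const_z _ _ h3
  have ekn := hc.const_z _ _ h4
  have bw : ∀ {a b}, ω a ≠ ω b → (fun t => (Q t).invDist a b) =O[l] (fun _ => (1 : ℝ)) :=
    fun hab => (h.swap.isBigO_invDist_of_ne hab).congr_left fun t => (h.equations t).invDist_swap _ _
  have b1 := h.isBigO_invDist_of_ne hζ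
  have b2 := h.isBigO_invDist_of_ne (i := i) (j := k) (by rwa [ekj])
  have b3 := h.isBigO_invDist_of_ne (i := i) (j := n) (by rwa [← ekn, ekj])
  have b4 := bw hω
  have b5 := bw (a := k) (b := n) (by rw [← ein, eij]; exact hω.symm)
  have hb : (fun t => (Q t).invDist j n) =O[l] (fun _ => (1 : ℝ)) := by
    have hmjn : (m j : ℂ) * m n ≠ 0 := by exact_mod_cast (mul_pos (hm j) (hm n)).ne'
    have := ((hI.sub (((((b1.const_mul_left ((m i : ℂ) * m j)).add
      (b2.const_mul_left ((m i : ℂ) * m k))).add (b3.const_mul_left ((m i : ℂ) * m n))).add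
      (b4.const_mul_left ((m j : ℂ) * m k))).add
      (b5.const_mul_left ((m k : ℂ) * m n)))).const_mul_left (((m j : ℂ) * m n)⁻¹))
    refine this.congr_left fun t => ?_
    have e := (h.equations t).two_mul_momentOfInertia
    simp only [sum_eq_of_distinct hij hik hin hjk hjn hkn] at e
    have hd : ∀ a, (Q t).invDist a a = 0 := fun a => by simp [ComplexPoint.invDist]
    rw [hd, hd, hd, hd, (h.equations t).invDist_symm j i, (h.equations t).invDist_symm k i,
      (h.equations t).invDist_symm n i, (h.equations t).invDist_symm k j,
      (h.equations t).invDist_symm n j, (h.equations t).invDist_symm n k] at e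
    rw [inv_mul_eq_iff_eq_mul₀ hmjn]
    linear_combination e / 2
  have hbs : (fun t => (Q t).swap.invDist j n) =O[l] (fun _ => (1 : ℝ)) :=
    hb.congr_left fun t => ((h.equations t).invDist_swap _ _).symm
  have zw : α j n = 0 → Tendsto (fun t => (Q t).w n - (Q t).w j) l (𝓝 0) :=
    h.tendsto_zero_of_triple hij hik hin hjk hjn hkn h1 h2 hω
  have zz : β j n = 0 → Tendsto (fun t => (Q t).z n - (Q t).z j) l (𝓝 0) :=
    h.swap.tendsto_zero_of_triple hjk.symm hik.symm hkn hij.symm hjn hin h3 h4 hζ.symm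
  have both : α j n = 0 → β j n = 0 → False := by
    intro ha hb'
    have e := ((hb.mul_tendsto_zero (zz hb')).mul (hb.mul_tendsto_zero (zw ha))).congr
      (f₂ := fun _ => (1 : ℂ)) fun t => by
        rw [← (h.equations t).invDist_sq hjn]; ring
    rw [mul_zero] at e
    exact one_ne_zero (tendsto_nhds_unique tendsto_const_nhds e)
  by_cases ha : α j n = 0
  · exact both ha (h.swap.stroke_eq_zero_of_tendsto hbs (zw ha))
  · by_cases hb' : β j n = 0
    · exact ha (h.stroke_eq_zero_of_tendsto hb (zz hb'))
    · refine h.rho_ne_zero_iff.mpr ⟨ha, hb'⟩ (tendsto_nhds_unique (h.tendsto_invDist j n) ?_)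
      exact (hb.mul_tendsto_zero h.tendsto_s).congr fun t => mul_comm _ _

/-! ### Limits concentrated at the origin -/

/-- When all limit positions are zero the strokes at a body cancel, so there is never just one. -/
theorem exists_other_stroke (h : SingularLimit η m l s Q 0 0 α β ρ) (hm : ∀ j, 0 < m j)
    {i j : Fin 4} (hij : α i j ≠ 0) : ∃ k, k ≠ j ∧ α i k ≠ 0 := by
  by_contra hcon
  push Not at hcon
  have h1 := h.force_z i
  rw [Finset.sum_eq_single j (fun k _ hk => by
    rw [h.antisymm, hcon k hk]; simp) (fun hj => absurd (Finset.mem_univ j) hj)] at h1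
  simp only [Pi.zero_apply, mul_zero, add_zero] at h1
  rcases mul_eq_zero.mp h1.symm with h2 | h2
  · exact (hm j).ne' (by exact_mod_cast h2)
  · exact h.stroke_symm hij h2

/-- The strokes of one colour contain a triangle or form a quadrilateral. -/
theorem exists_triangle_or_quadrilateral (h : SingularLimit η m l s Q 0 0 α β ρ)
    (hm : ∀ j, 0 < m j) (hα : α ≠ 0) :
    (∃ i j k, α i j ≠ 0 ∧ α j k ≠ 0 ∧ α i k ≠ 0) ∨
    ∃ i j k n, i ≠ j ∧ i ≠ k ∧ i ≠ n ∧ j ≠ k ∧ j ≠ n ∧ k ≠ n ∧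
      α i j ≠ 0 ∧ α j k ≠ 0 ∧ α k n ≠ 0 ∧ α n i ≠ 0 ∧ α i k = 0 ∧ α j n = 0 := by
  by_contra hcon
  push Not at hcon
  obtain ⟨hT, hC⟩ := hcon
  obtain ⟨i, hi⟩ := Function.ne_iff.mp hα
  obtain ⟨j, hij⟩ := Function.ne_iff.mp hi
  obtain ⟨k, hki, hjk⟩ := h.exists_other_stroke hm (h.stroke_symm hij)
  have nij := h.ne_of_stroke hij
  have njk := h.ne_of_stroke hjk
  obtain ⟨n, hin, hjn, hkn⟩ := exists_fourth i j k
  have hik := hT i j k hij hjk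
  have hni : α n i ≠ 0 := by
    obtain ⟨x, hx, hix⟩ := h.exists_other_stroke hm hij
    rcases eq_of_distinct nij hki.symm hin njk hjn hkn x with rfl | rfl | rfl | rfl
    · exact absurd (h.diag _) hix
    · exact absurd rfl hx
    · exact absurd hik hix
    · exact h.stroke_symm hix
  have hkn' : α k n ≠ 0 := by
    obtain ⟨x, hx, hkx⟩ := h.exists_other_stroke hm (h.stroke_symm hjk)
    rcases eq_of_distinct nij hki.symm hin njk hjn hkn x with rfl | rfl | rfl | rfl
    · exact absurd hik (h.stroke_symm hkx)
    · exact absurd rfl hx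
    · exact absurd (h.diag _) hkx
    · exact hkx
  have hjn' : α j n ≠ 0 := hC i j k n nij hki.symm hin njk hjn hkn hij hjk hkn' hni hik
  exact hT i j n hij hjn' |> fun e => h.stroke_symm hni e

/-- When the strokes of one colour contain a triangle, either all pairs carry both colours, or three
bodies are joined by strokes of both colours and the fourth body carries no stroke. -/
theorem full_or_triangle_of_triangle (h : SingularLimit η m l s Q 0 0 α β ρ) (hm : ∀ j, 0 < m j)
    (hβ : β ≠ 0) {i j k : Fin 4} (hij : α i j ≠ 0) (hjk : α j k ≠ 0) (hik : α i k ≠ 0) :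
    (∀ a b, a ≠ b → ρ a b ≠ 0) ∨ ∃ i j k n, i ≠ j ∧ i ≠ k ∧ i ≠ n ∧ j ≠ k ∧ j ≠ n ∧ k ≠ n ∧
      ρ i j ≠ 0 ∧ ρ j k ≠ 0 ∧ ρ i k ≠ 0 ∧ (∀ a, α n a = 0) ∧ ∀ a, β n a = 0 := by
  have nij := h.ne_of_stroke hij
  have njk := h.ne_of_stroke hjk
  have nik := h.ne_of_stroke hik
  obtain ⟨n, hin, hjn, hkn⟩ := exists_fourth i j k
  have hx := eq_of_distinct nij nik hin njk hjn hkn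
  have bs := fun {a b} => h.swap.stroke_symm (i := a) (j := b)
  have as := fun {a b} => h.stroke_symm (i := a) (j := b)
  have hall : β i j ≠ 0 ∧ β j k ≠ 0 ∧ β i k ≠ 0 := by
    have c1 : β i j ≠ 0 → β i j ≠ 0 ∧ β j k ≠ 0 ∧ β i k ≠ 0 := fun hb =>
      ⟨hb, h.triangle hij hjk hik hb⟩
    have c2 : β j k ≠ 0 → β i j ≠ 0 ∧ β j k ≠ 0 ∧ β i k ≠ 0 := fun hb =>
      have := h.triangle hjk (as hik) (as hij) hb
      ⟨bs this.2, hb, bs this.1⟩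
    have c3 : β i k ≠ 0 → β i j ≠ 0 ∧ β j k ≠ 0 ∧ β i k ≠ 0 := fun hb =>
      have := h.triangle hik (as hjk) hij hb
      ⟨this.2, bs this.1, hb⟩
    by_contra hcon
    have n1 : β i j = 0 := by by_contra hb; exact hcon (c1 hb)
    have n2 : β j k = 0 := by by_contra hb; exact hcon (c2 hb)
    have n3 : β i k = 0 := by by_contra hb; exact hcon (c3 hb)
    -- Every stroke of the second colour would end at `n`, and its other end would have no other one.
    have hend : ∀ a b, a ≠ n → β a b ≠ 0 → b = n := by
      intro a b ha hb
      have hb' := bs hb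
      rcases hx a with rfl | rfl | rfl | rfl <;> rcases hx b with rfl | rfl | rfl | rfl <;>
        first
        | rfl
        | exact absurd rfl ha
        | exact absurd (h.swap.diag _) hb
        | exact absurd n1 hb
        | exact absurd n2 hb
        | exact absurd n3 hb
        | exact absurd n1 hb'
        | exact absurd n2 hb'
        | exact absurd n3 hb'
    have hno : ∀ a b, a ≠ n → β a b = 0 := by
      intro a b ha
      by_contra hb
      obtain ⟨c, hc, hac⟩ := h.swap.exists_other_stroke hm hb
      exact hc ((hend a c ha hac).trans (hend a b ha hb).symm)
    refine hβ (funext fun a => funext fun b => ?_)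
    by_cases ha : a = n
    · by_contra hb
      have hbn : b = n := by
        by_contra hbn
        exact bs hb (hno b a hbn)
      rw [ha, hbn] at hb
      exact hb (h.swap.diag n)
    · exact hno a b ha
  have rij := h.rho_ne_zero_iff.mpr ⟨hij, hall.1⟩
  have rjk := h.rho_ne_zero_iff.mpr ⟨hjk, hall.2.1⟩
  have rik := h.rho_ne_zero_iff.mpr ⟨hik, hall.2.2⟩
  have rs : ∀ {a b}, ρ a b ≠ 0 → ρ b a ≠ 0 := fun {a b} hab => by rwa [h.rho_symm]
  have hr : ∀ a b, a ≠ n → b ≠ n → a ≠ b → ρ a b ≠ 0 := by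
    intro a b ha hb hab
    rcases hx a with rfl | rfl | rfl | rfl <;> rcases hx b with rfl | rfl | rfl | rfl <;>
      first
      | exact absurd rfl hab
      | exact absurd rfl ha
      | exact absurd rfl hb
      | assumption
      | exact rs ‹_›
  have full : ∀ a, ρ n a ≠ 0 → ∀ a b, a ≠ b → ρ a b ≠ 0 := by
    intro a hna
    have han : a ≠ n := (h.ne_of_stroke (h.rho_ne_zero_iff.mp hna).1).symm
    have hn : ∀ b, b ≠ n → ρ n b ≠ 0 := fun b hb => by
      by_cases hab : a = b
      · rwa [← hab]
      · exact h.rho_trans (Ne.symm hb) hna (hr a b han hb hab)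
    intro b c hbc
    by_cases hb : b = n
    · subst hb; exact hn c (Ne.symm hbc)
    · by_cases hc : c = n
      · subst hc; exact rs (hn b hb)
      · exact hr b c hb hc hbc
  by_cases ha : ∀ a, α n a = 0
  · by_cases hb : ∀ a, β n a = 0
    · exact .inr ⟨i, j, k, n, nij, nik, hin, njk, hjn, hkn, rij, rjk, rik, ha, hb⟩
    · push Not at hb
      obtain ⟨a, hna⟩ := hb
      obtain ⟨b, hba, hnb⟩ := h.swap.exists_other_stroke hm hna
      have han := (h.swap.ne_of_stroke hna).symm
      have hbn := (h.swap.ne_of_stroke hnb).symm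
      have hab := h.rho_ne_zero_iff.mp (hr a b han hbn (Ne.symm hba))
      have := h.swap.triangle hab.2 (bs hnb) (bs hna) hab.1
      exact absurd (ha a) (h.stroke_symm this.2)
  · push Not at ha
    obtain ⟨a, hna⟩ := ha
    obtain ⟨b, hba, hnb⟩ := h.exists_other_stroke hm hna
    have han := (h.ne_of_stroke hna).symm
    have hbn := (h.ne_of_stroke hnb).symm
    have hab := h.rho_ne_zero_iff.mp (hr a b han hbn (Ne.symm hba))
    have := h.triangle hab.1 (as hnb) (as hna) hab.2
    exact .inl (full a (h.rho_ne_zero_iff.mpr ⟨hna, bs this.2⟩))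

theorem full_or_triangle (h : SingularLimit η m l s Q 0 0 α β ρ) (hm : ∀ j, 0 < m j)
    (hα : α ≠ 0) (hβ : β ≠ 0) :
    (∀ a b, a ≠ b → ρ a b ≠ 0) ∨ ∃ i j k n, i ≠ j ∧ i ≠ k ∧ i ≠ n ∧ j ≠ k ∧ j ≠ n ∧ k ≠ n ∧
      ρ i j ≠ 0 ∧ ρ j k ≠ 0 ∧ ρ i k ≠ 0 ∧ (∀ a, α n a = 0) ∧ ∀ a, β n a = 0 := by
  rcases h.exists_triangle_or_quadrilateral hm hα with ⟨i, j, k, h1, h2, h3⟩ |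
    ⟨i, j, k, n, hij, hik, hin, hjk, hjn, hkn, h1, h2, h3, h4, h5, h6⟩
  · exact h.full_or_triangle_of_triangle hm hβ h1 h2 h3
  -- In a quadrilateral of one colour, a path of two strokes of the other colour closes up.
  obtain ⟨a, ha⟩ := Function.ne_iff.mp hβ
  obtain ⟨b, hab⟩ := Function.ne_iff.mp ha
  obtain ⟨c, hca, hbc⟩ := h.swap.exists_other_stroke hm (h.swap.stroke_symm hab)
  have hac : α a c ≠ 0 := by
    intro h0
    have hx := eq_of_distinct hij hik hin hjk hjn hkn
    have as := fun {a b} => h.stroke_symm (i := a) (j := b)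
    have nab := h.swap.ne_of_stroke hab
    have nbc := h.swap.ne_of_stroke hbc
    have key : α a b ≠ 0 → α b c ≠ 0 → False := fun e1 e2 =>
      (h.rho_ne_zero_iff.mp (h.rho_trans (Ne.symm hca) (h.rho_ne_zero_iff.mpr ⟨e1, hab⟩)
        (h.rho_ne_zero_iff.mpr ⟨e2, hbc⟩))).1 h0
    rcases hx a with rfl | rfl | rfl | rfl <;> rcases hx c with rfl | rfl | rfl | rfl <;>
      first
      | exact absurd rfl hca
      | exact absurd h0 ‹_›
      | exact absurd h0 (as ‹_›)
      | (rcases hx b with rfl | rfl | rfl | rfl <;>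
          first
          | exact absurd rfl nab
          | exact absurd rfl nbc
          | exact key (by first | assumption | exact as ‹_›) (by first | assumption | exact as ‹_›))
  have hbac := h.both_of_path hab hbc hac
  rcases h.swap.full_or_triangle_of_triangle hm hα hab hbc hbac with hf |
    ⟨i, j, k, n, a1, a2, a3, a4, a5, a6, a7, a8, a9, a10, a11⟩
  · exact .inl hf
  · exact .inr ⟨i, j, k, n, a1, a2, a3, a4, a5, a6, a7, a8, a9, a11, a10⟩

/-- If all pairs carry strokes of both colours, all bodies tend to the centre of mass, and the moment
of inertia tends to zero. -/
theorem tendsto_momentOfInertia_of_full (h : SingularLimit η m l s Q ζ ω α β ρ) (hη₀ : 0 < η)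
    (hη₁ : η < 1) (hm : ∀ j, 0 < m j) (hρ : ∀ a b, a ≠ b → ρ a b ≠ 0) :
    Tendsto (fun n => (Q n).momentOfInertia η m) l (𝓝 0) := by
  have key : ∀ {Q : ℕ → ComplexPoint} {ζ ω : Fin 4 → ℂ} {α β : Fin 4 → Fin 4 → ℂ},
      SingularLimit η m l s Q ζ ω α β ρ → ∀ j, Tendsto (fun n => (Q n).z j) l (𝓝 0) := by
    intro Q ζ ω α β h j
    have hM : (∑ k, (m k : ℂ)) ≠ 0 := by
      exact_mod_cast (Finset.sum_pos (fun k _ => hm k) Finset.univ_nonempty).ne'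
    have hcenter : ∀ n, ∑ k, (m k : ℂ) * (Q n).z k = 0 := by
      intro n
      have h1 := two_smul_sum_antisymm (fun j => (m j : ℂ)) (Q n).Z (h.equations n).antisymm_Z
        (fun _ => (1 : ℂ))
      have h2 := two_smul_sum_antisymm (fun j => (m j : ℂ)) (Q n).W (h.equations n).antisymm_W
        (fun _ => (1 : ℂ))
      simp only [sub_self, mul_zero, Finset.sum_const_zero, smul_eq_mul, mul_one, mul_eq_zero,
        two_ne_zero, false_or] at h1 h2
      have f1 : ∑ j, (m j : ℂ) * ((Q n).z j + η * (Q n).w j) = 0 := by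
        rw [← h1]
        refine Finset.sum_congr rfl fun j _ => ?_
        have := (h.equations n).force_z j
        simp only [Algebra.algebraMap_self, RingHom.id_apply] at this
        rw [this, Finset.mul_sum]
        exact Finset.sum_congr rfl fun k _ => by ring
      have f2 : ∑ j, (m j : ℂ) * ((Q n).w j + η * (Q n).z j) = 0 := by
        rw [← h2]
        refine Finset.sum_congr rfl fun j _ => ?_
        have := (h.equations n).force_w j
        simp only [Algebra.algebraMap_self, RingHom.id_apply] at this
        rw [this, Finset.mul_sum]
        exact Finset.sum_congr rfl fun k _ => by ring
      refine (mul_eq_zero.mp ?_).resolve_left (one_sub_sq_ne_zero hη₀ hη₁)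
      simp only [Fin.sum_univ_four] at f1 f2 ⊢
      linear_combination f1 - η * f2
    have hdiff : ∀ k, Tendsto (fun n => (Q n).z j - (Q n).z k) l (𝓝 0) := by
      intro k
      by_cases hkj : k = j
      · subst hkj; simp
      · exact h.swap.tendsto_zero_of_stroke (h.rho_ne_zero_iff.mp (hρ k j hkj)).2
    have h3 := (tendsto_finsetSum Finset.univ fun k _ =>
      (hdiff k).const_mul (m k : ℂ)).const_mul ((∑ k, (m k : ℂ))⁻¹)
    simp only [mul_zero, Finset.sum_const_zero] at h3
    refine h3.congr fun n => ?_
    rw [inv_mul_eq_iff_eq_mul₀ hM]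
    simp only [mul_sub, Finset.sum_sub_distrib, hcenter, sub_zero, Finset.sum_mul]
  have hz := key h
  have hw := key h.swap
  have h4 := (tendsto_finsetSum Finset.univ fun j _ =>
    (((((hz j).const_mul 2).mul (hw j)).add ((((hz j).pow 2).add ((hw j).pow 2)).const_mul
      (η : ℂ))).const_mul (m j : ℂ))).const_mul (2 : ℂ)⁻¹
  simp only [mul_zero, ne_eq, OfNat.ofNat_ne_zero, not_false_eq_true, zero_pow, add_zero,
    Finset.sum_const_zero] at h4
  refine h4.congr fun n => ?_
  rw [inv_mul_eq_iff_eq_mul₀ two_ne_zero, (Q n).two_mul_momentOfInertia]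
  rfl

/-- The strokes of one colour in an isolated triangle are determined by their sum at each vertex:
they are proportional to the mass of the opposite body. -/
theorem strokes_of_isolated_triangle (h : SingularLimit η m l s Q 0 0 α β ρ) (hm : ∀ j, 0 < m j)
    {i j k n : Fin 4} (hij : i ≠ j) (hik : i ≠ k) (hin : i ≠ n) (hjk : j ≠ k) (hjn : j ≠ n)
    (hkn : k ≠ n) (hα : ∀ a, α n a = 0) :
    ∃ c : ℂ, α i j = m k * c ∧ α j k = m i * c ∧ α k i = m j * c := by
  have hne : ∀ a, (m a : ℂ) ≠ 0 := fun a => by exact_mod_cast (hm a).ne'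
  have h1 := h.force_z i
  have h2 := h.force_z j
  rw [sum_eq_of_distinct hij hik hin hjk hjn hkn, hα, h.diag, h.antisymm j i] at h1
  rw [sum_eq_of_distinct hij hik hin hjk hjn hkn, hα, h.diag, h.antisymm k j] at h2
  simp only [Pi.zero_apply, mul_zero, add_zero, zero_add] at h1 h2
  refine ⟨α i j / m k, ?_, ?_, ?_⟩
  · rw [mul_div_cancel₀ _ (hne k)]
  · rw [mul_div_assoc', eq_div_iff (hne k)]; linear_combination h2
  · rw [mul_div_assoc', eq_div_iff (hne k)]; linear_combination -h1

/-- Condition VIII is the closing of an isolated triangle of both colours: by the shape of the strokes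
the three numbers `s / (r √m)`, with `m` the mass opposite to the side, have limits with the same
fourth power, and the sides are their multiples by `1 / √m` up to a common factor. -/
theorem massConditionVIII_of_triangle (h : SingularLimit η m l s Q 0 0 α β ρ) (hm : ∀ j, 0 < m j)
    {i j k n : Fin 4} (hij : i ≠ j) (hik : i ≠ k) (hin : i ≠ n) (hjk : j ≠ k) (hjn : j ≠ n)
    (hkn : k ≠ n) (rij : ρ i j ≠ 0) (rjk : ρ j k ≠ 0) (rik : ρ i k ≠ 0)
    (hα : ∀ a, α n a = 0) (hβ : ∀ a, β n a = 0) :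
    MassConditionVIII (m k) (m i) (m j) ∨ MassConditionVIII (m i) (m k) (m j) ∨
      MassConditionVIII (m j) (m k) (m i) := by
  obtain ⟨c, c1, c2, c3⟩ := h.strokes_of_isolated_triangle hm hij hik hin hjk hjn hkn hα
  obtain ⟨d, d1, d2, d3⟩ := h.swap.strokes_of_isolated_triangle hm hij hik hin hjk hjn hkn hβ
  have rki : ρ k i ≠ 0 := by rwa [h.rho_symm]
  obtain ⟨x, hx⟩ := h.closeZ_of_stroke (h.rho_ne_zero_iff.mp rij).2
  obtain ⟨y, hy⟩ := h.closeZ_of_stroke (h.rho_ne_zero_iff.mp rjk).2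
  obtain ⟨z, hz⟩ := h.closeZ_of_stroke (h.rho_ne_zero_iff.mp rki).2
  have hxyz : x + y + z = 0 :=
    tendsto_nhds_unique ((hx.add hy).add hz) (tendsto_const_nhds.congr fun t => by ring)
  have x3 := h.mul_rho_cube hx
  have y3 := h.mul_rho_cube hy
  have z3 := h.mul_rho_cube hz
  have x4 := h.rho_pow_four i j
  have y4 := h.rho_pow_four j k
  have z4 := h.rho_pow_four k i
  rw [c1] at x3 x4; rw [c2] at y3 y4; rw [c3] at z3 z4
  rw [d1] at x4; rw [d2] at y4; rw [d3] at z4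
  have hsq : ∀ a, ((√(m a) : ℝ) : ℂ) ^ 2 = m a := fun a => by
    rw [← Complex.ofReal_pow, Real.sq_sqrt (hm a).le]
  have hs0 : ∀ a, 0 < √(m a) := fun a => Real.sqrt_pos.mpr (hm a)
  have hsne : ∀ a, ((√(m a) : ℝ) : ℂ) ≠ 0 := fun a => by exact_mod_cast (hs0 a).ne'
  have hcd : c * d ≠ 0 := by
    intro h0
    refine rij (pow_eq_zero_iff four_ne_zero |>.mp ?_)
    rw [x4]; linear_combination (m k : ℂ) ^ 2 * h0
  -- The three numbers `ρ / √m` have the same fourth power `c d`.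
  have t4 : ∀ (a : Fin 4) (r : ℂ), r ^ 4 = m a * c * (m a * d) → (r / √(m a)) ^ 4 = c * d := by
    intro a r hr
    rw [div_pow, hr, div_eq_iff (pow_ne_zero _ (hsne a))]
    rw [← hsq a]; ring
  have tx : ∀ (a : Fin 4) (r x : ℂ), r ^ 4 = m a * c * (m a * d) → x * r ^ 3 = m a * c →
      ((1 / √(m a) : ℝ) : ℂ) * (r / √(m a)) = d * x := by
    intro a r x h4 h3
    have hma : (m a : ℂ) ≠ 0 := by exact_mod_cast (hm a).ne'
    have e : r = m a * d * x := mul_left_cancel₀ (mul_ne_zero hma (left_ne_zero_of_mul hcd)) (by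
      linear_combination -r * h3 + x * h4)
    push_cast
    rw [div_mul_div_comm, ← pow_two, hsq, div_eq_iff hma, e]; ring
  have hsum : ((1 / √(m k) : ℝ) : ℂ) * (ρ i j / √(m k)) + ((1 / √(m i) : ℝ) : ℂ) *
      (ρ j k / √(m i)) + ((1 / √(m j) : ℝ) : ℂ) * (ρ k i / √(m j)) = 0 := by
    rw [tx k _ _ x4 x3, tx i _ _ y4 y3, tx j _ _ z4 z3]
    linear_combination d * hxyz
  exact eq_add_of_fourth_roots (one_div_pos.mpr (hs0 k)) (one_div_pos.mpr (hs0 i))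
    (one_div_pos.mpr (hs0 j)) (div_ne_zero rij (hsne k)) ((t4 i _ y4).trans (t4 k _ x4).symm)
    ((t4 j _ z4).trans (t4 k _ x4).symm) hsum

end SingularLimit

/-- The rescaled limit of a singular sequence of equal order is either concentrated at the origin,
which leaves the full diagram and the isolated triangle, or separates the bodies, which leaves the
overlapping triples. -/
theorem not_isOfEqualOrder {η : ℝ} (hη₀ : 0 < η) (hη₁ : η < 1) {m : Fin 4 → ℝ}
    (hm : ∀ j, 0 < m j) (hM : m ∉ exceptionalMasses η) {Q : ℕ → ComplexPoint}
    (hQ : IsSingularSequence {P | P ∈ balancedVariety η m ∧ P.momentOfInertia η m ≠ 0} Q) :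
    ¬ IsOfEqualOrder Q := by
  intro hE
  obtain ⟨l, s, ζ, ω, α, β, ρ, hl, h, hz, hw⟩ :=
    exists_singularLimit hη₀ hη₁ (fun n => (hQ.1 n).1) hQ.2 hE
  have hfin := finite_momentOfInertia_image hη₀ hη₁ m
  by_cases h0 : ζ = 0 ∧ ω = 0
  · obtain ⟨rfl, rfl⟩ := h0
    rcases h.full_or_triangle hm (fun e => hz ⟨rfl, e⟩) (fun e => hw ⟨rfl, e⟩) with hf |
      ⟨i, j, k, n, hij, hik, hin, hjk, hjn, hkn, h1, h2, h3, h4, h5⟩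
    · -- The nonzero values of the moment of inertia form a finite, hence closed, set.
      have hclosed := (hfin.subset (Set.sdiff_subset (t := {(0 : ℂ)}))).isClosed
      have := hclosed.mem_of_tendsto (h.tendsto_momentOfInertia_of_full hη₀ hη₁ hm hf)
        (Filter.Eventually.of_forall fun n => ⟨⟨_, (hQ.1 n).1, rfl⟩, (hQ.1 n).2⟩)
      exact this.2 rfl
    · rcases h.massConditionVIII_of_triangle hm hij hik hin hjk hjn hkn h1 h2 h3 h4 h5 with
        h6 | h6 | h6
      · obtain ⟨σ, rfl, rfl, rfl, rfl⟩ :=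
          exists_perm_of_distinct hik.symm hjk.symm hkn hij hin hjn
        exact hM ⟨σ, .inr (.inr (.inr (.inr (.inr h6))))⟩
      · obtain ⟨σ, rfl, rfl, rfl, rfl⟩ :=
          exists_perm_of_distinct hik hij hin hjk.symm hkn hjn
        exact hM ⟨σ, .inr (.inr (.inr (.inr (.inr h6))))⟩
      · obtain ⟨σ, rfl, rfl, rfl, rfl⟩ :=
          exists_perm_of_distinct hjk hij.symm hjn hik.symm hkn hin
        exact hM ⟨σ, .inr (.inr (.inr (.inr (.inr h6))))⟩
  · obtain ⟨i, j, k, n, hij, hik, hin, hjk, hjn, hkn, h1, h2, h3, h4, h5, h6⟩ :=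
      h.classRelations.exists_overlapping_triples hη₀ hη₁ hm hM h0
    refine h.not_overlapping_triples hm ?_ hij hik hin hjk hjn hkn h1 h2 h3 h4 h5 h6
    obtain ⟨C, hC⟩ := hfin.isBounded.exists_norm_le
    refine IsBigO.of_bound C (Filter.Eventually.of_forall fun n => ?_)
    rw [norm_one, mul_one]
    exact hC _ ⟨_, (hQ.1 n).1, rfl⟩

theorem mainTheorem4 (η : ℝ) (hη₀ : 0 < η) (hη₁ : η < 1)
    (m : Fin 4 → ℝ) (hm : ∀ j, 0 < m j) (hM : m ∉ exceptionalMasses η) :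
    ((normalizedBalancedConfigurations η m).Infinite →
      ∃ Q : ℕ → ComplexPoint, IsSingularSequence (realBalancedVariety η m) Q) ∧
    (∀ Q : ℕ → ComplexPoint,
      IsSingularSequence (realBalancedVariety η m) Q → ¬ IsOfEqualOrder Q) ∧
    (∀ Q : ℕ → ComplexPoint,
      IsSingularSequence {P | P ∈ balancedVariety η m ∧ P.momentOfInertia η m ≠ 0} Q →
        ¬ IsOfEqualOrder Q) := by
  refine ⟨exists_isSingularSequence_of_infinite hη₀ hη₁, fun Q hQ => ?_,
    fun Q hQ => not_isOfEqualOrder hη₀ hη₁ hm hM hQ⟩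
  exact not_isOfEqualOrder hη₀ hη₁ hm hM ⟨fun n => ⟨(hQ.1 n).1,
    momentOfInertia_ne_zero_of_mem_real hη₀ hη₁ hm (hQ.1 n)⟩, hQ.2⟩
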